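/- **Notation.** For $u,v\in\mathbb R^m$ let $\sigma(u,v)=|u^{T}v|/(\|u\|_2\|v\|_2)$. For $A\in\mathbb R^{m\times n}$ and $B\in\mathbb R^{m\times\ell}$ with $p=\operatorname{rank}A\ge q=\operatorname{rank}B$, the canonical correlations $\sigma_1(A,B)\ge\dots\ge\sigma_q(A,B)$ are defined recursively by $$\sigma_i(A,B)=\max_{x\in\mathcal A_i,\,y\in\mathcal B_i}\sigma(Ax,By)=\sigma(Ax_i,By_i),$$ where $\mathcal A_i=\{x: Ax\ne0,\ Ax\perp Ax_1,\dots,Ax_{i-1}\}$ and $\mathcal B_i=\{y: By\ne0,\ By\perp By_1,\dots,By_{i-1}\}$. The vectors $x_i/\|Ax_i\|_2$ and $y_i/\|By_i\|_2$ are called canonical weights. The same definition is used for any pair of matrices with equally many rows, with $\min(\operatorname{rank}A,\operatorname{rank}B)$ in place of $q$. For $0\le\eta\le1$, an *$\eta$-approximate CCA* of $(A,B)$ consists of numbers $\hat\sigma_1,\dots,\hat\sigma_q\ge0$ and vectors $w_1,\dots,w_q\in\mathbb R^n$, $p_1,\dots,p_q\in\mathbb R^\ell$ such that for all $i$ and all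 $j\neq i$: (a) $|\sigma_i(A,B)-\hat\sigma_i|\le\eta$; (b) $|\|Aw_i\|_2^2-1|\le\eta$ and $|\langle Aw_i,Aw_j\rangle|\le\eta$, and likewise for the vectors $Bp_i$; (c) $|\sigma_i(A,B)-\sigma(Aw_i,Bp_i)|\le\eta$. The number of nonzero entries of $A$ is $\operatorname{nnz}(A)$, and $[A;B]$ is the matrix whose columns are those of $A$ followed by those of $B$. **Algorithm.** The input is $A\in\mathbb R^{m\times n}$ and $B\in\mathbb R^{m\times\ell}$ with $m,n\ge1$, $n\ge\ell$, $\operatorname{rank}A\ge\operatorname{rank}B$, and numbers $0<\varepsilon<1/3$, $0<\delta<1$. Put $$r=\min\Big(\Big\lceil\frac{243\,((n+\ell)^2+n+\ell)}{\varepsilon^2\delta}\Big\rceil,\ m\Big).$$ Draw the columns of $S\in\mathbb R^{r\times m}$ independently and uniformly from the $r$ standard basis vectors of $\mathbb R^r$ and, independently, a diagonal matrix $D\in\mathbb R^{m\times m}$ with independent uniform diagonal entries $\pm1$. Form $\hat A=S(DA)$ and $\hat B=S(DB)$, and return the exact canonical correlations and canonical weights of $(\hat A,\hat B)$, obtained by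 any method, for instance by the Björck–Golub algorithm: compute orthonormal bases $Q$, $W$ of the column spaces of $\hat A$ and $\hat B$ by a (modified Gram–Schmidt) QR decomposition, and then a singular value decomposition of $Q^TW$. **Theorem.** There are absolute constants $C_1,C_2>0$ such that the following holds for all such inputs. 1. Let $\omega=\operatorname{rank}[A;B]$ and suppose that $243(\omega^2+\omega)/(\varepsilon^2\delta)\le m$. Then, with probability at least $1-\delta$ over $S$ and $D$, every exact choice of canonical correlations and canonical weights of $(\hat A,\hat B)$, and hence the output of the algorithm, is a $C_1\varepsilon$-approximate CCA of $(A,B)$. 2. If the Björck–Golub algorithm is used in the last step, and $A$ and $B$ are given as lists of their nonzero entries, then for every outcome of the random choices the algorithm outputs exact canonical correlations and canonical weights of $(\hat A,\hat B)$ after at most $$C_2\big(m+\operatorname{nnz}(A)+\operatorname{nnz}(B)+n^4\varepsilon^{-2}\delta^{-1}\big)$$ steps. Here each real arithmetic operation, square root, zero test, array access, loop iteration and random draw counts as one step, computing $r$ counts as a bounded number of steps, and an exact singular value decomposition of a $k\times l$ matrix counts as $(k+l)^3$ steps. -/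

import Mathlib

open scoped Matrix

noncomputable section

namespace CCA

/-! ### Canonical correlation analysis -/

/-- The Euclidean norm of a vector of `ℝ^m`. -/
def l2norm {m : ℕ} (u : Fin m → ℝ) : ℝ :=
  ‖(WithLp.toLp 2 u : EuclideanSpace ℝ (Fin m))‖

/-- `σ(u, v) = |uᵀ v| / (‖u‖ ‖v‖)`. -/
def cosine {m : ℕ} (u v : Fin m → ℝ) : ℝ :=
  |u ⬝ᵥ v| / (l2norm u * l2norm v)

/-- The vectors `z` with `A z ≠ 0` and `A z ⟂ A x_j` for all `j < i`. -/
def admissible {m n k : ℕ} (A : Matrix (Fin m) (Fin n) ℝ) (x : Fin k → Fin n → ℝ) (i : Fin k) :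
    Set (Fin n → ℝ) :=
  {z | A *ᵥ z ≠ 0 ∧ ∀ j < i, (A *ᵥ z) ⬝ᵥ (A *ᵥ x j) = 0}

/-- The pairs `(x_i, y_i)` arise from the recursive definition of canonical correlations: for every
`i`, the pair `(x_i, y_i)` maximizes `σ(A x, B y)` over all `x`, `y` that are admissible with
respect to the earlier pairs. -/
def IsCanonicalSystem {m n l k : ℕ} (A : Matrix (Fin m) (Fin n) ℝ) (B : Matrix (Fin m) (Fin l) ℝ)
    (x : Fin k → Fin n → ℝ) (y : Fin k → Fin l → ℝ) : Prop :=
  ∀ i, x i ∈ admissible A x i ∧ y i ∈ admissible B y i ∧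
    ∀ x' ∈ admissible A x i, ∀ y' ∈ admissible B y i,
      cosine (A *ᵥ x') (B *ᵥ y') ≤ cosine (A *ᵥ x i) (B *ᵥ y i)

/-- `σ` lists the first `k` canonical correlations `σ_1(A, B), …, σ_k(A, B)`. -/
def IsCanonicalCorrelations {m n l k : ℕ} (A : Matrix (Fin m) (Fin n) ℝ)
    (B : Matrix (Fin m) (Fin l) ℝ) (σ : Fin k → ℝ) : Prop :=
  ∃ (x : Fin k → Fin n → ℝ) (y : Fin k → Fin l → ℝ), IsCanonicalSystem A B x y ∧
    ∀ i, σ i = cosine (A *ᵥ x i) (B *ᵥ y i)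

/-- What a CCA procedure returns: a number of correlations, the correlations, and the weight
vectors for the first and for the second matrix. -/
structure Output (n l : ℕ) where
  num : ℕ
  corr : Fin num → ℝ
  wA : Fin num → Fin n → ℝ
  wB : Fin num → Fin l → ℝ

/-- `out` consists of the exact canonical correlations of `(A, B)`, as many as the smaller of the
two ranks, together with canonical weights, normalized by `‖A w_i‖ = 1 = ‖B p_i‖`. -/
structure IsExactCCA {m n l : ℕ} (A : Matrix (Fin m) (Fin n) ℝ) (B : Matrix (Fin m) (Fin l) ℝ)
    (out : Output n l) : Prop where
  num_eq : out.num = min A.rank B.rank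
  system : IsCanonicalSystem A B out.wA out.wB
  normA : ∀ i, l2norm (A *ᵥ out.wA i) = 1
  normB : ∀ i, l2norm (B *ᵥ out.wB i) = 1
  corr_eq : ∀ i, out.corr i = cosine (A *ᵥ out.wA i) (B *ᵥ out.wB i)

/-- `out` is an `η`-approximate CCA of `(A, B)`. -/
structure IsApproxCCA {m n l : ℕ} (A : Matrix (Fin m) (Fin n) ℝ) (B : Matrix (Fin m) (Fin l) ℝ)
    (η : ℝ) (out : Output n l) : Prop where
  eta_nonneg : 0 ≤ η
  eta_le_one : η ≤ 1
  num_eq : out.num = min A.rank B.rank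
  corr_nonneg : ∀ i, 0 ≤ out.corr i
  /-- The canonical correlations of `(A, B)` exist, whichever maximizers are chosen. -/
  exists_corr : ∃ σ : Fin out.num → ℝ, IsCanonicalCorrelations A B σ
  corr_close : ∀ σ : Fin out.num → ℝ, IsCanonicalCorrelations A B σ →
    ∀ i, |σ i - out.corr i| ≤ η
  normA : ∀ i, |l2norm (A *ᵥ out.wA i) ^ 2 - 1| ≤ η
  orthA : ∀ i j, i ≠ j → |(A *ᵥ out.wA i) ⬝ᵥ (A *ᵥ out.wA j)| ≤ η
  normB : ∀ i, |l2norm (B *ᵥ out.wB i) ^ 2 - 1| ≤ η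
  orthB : ∀ i j, i ≠ j → |(B *ᵥ out.wB i) ⬝ᵥ (B *ᵥ out.wB j)| ≤ η
  cosine_close : ∀ σ : Fin out.num → ℝ, IsCanonicalCorrelations A B σ →
    ∀ i, |σ i - cosine (A *ᵥ out.wA i) (B *ᵥ out.wB i)| ≤ η

/-! ### Singular value decomposition -/

/-- A tuple of matrices of the shape of a thin SVD of a `k × l` matrix. -/
structure SVDData (k l : ℕ) where
  U : Matrix (Fin k) (Fin (min k l)) ℝ
  s : Fin (min k l) → ℝ
  V : Matrix (Fin l) (Fin (min k l)) ℝ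

/-- `M = U diag(s) Vᵀ`, `U` and `V` have orthonormal columns, and `s_1 ≥ s_2 ≥ … ≥ 0`. -/
structure IsSVD {k l : ℕ} (M : Matrix (Fin k) (Fin l) ℝ) (D : SVDData k l) : Prop where
  orthU : D.Uᵀ * D.U = 1
  orthV : D.Vᵀ * D.V = 1
  nonneg : ∀ i, 0 ≤ D.s i
  anti : Antitone D.s
  eq : M = D.U * Matrix.diagonal D.s * D.Vᵀ

theorem exists_svd_tall {k l : ℕ} (h : l ≤ k) (M : Matrix (Fin k) (Fin l) ℝ) :
    ∃ (U : Matrix (Fin k) (Fin l) ℝ) (s : Fin l → ℝ) (V : Matrix (Fin l) (Fin l) ℝ),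
      Uᵀ * U = 1 ∧ Vᵀ * V = 1 ∧ (∀ i, 0 ≤ s i) ∧ Antitone s ∧ M = U * Matrix.diagonal s * Vᵀ := by
  have orth : ∀ {N : ℕ} {ι : Type} (b : ι → EuclideanSpace ℝ (Fin N)) (i j : ι),
      ∑ a, b i a * b j a = inner ℝ (b i) (b j) := by
    intro N ι b i j
    simp [PiLp.inner_apply, mul_comm]
  let T := Matrix.toEuclideanLin M
  have hT := T.isSymmetric_adjoint_comp_self
  have hn : Module.finrank ℝ (EuclideanSpace ℝ (Fin l)) = l := by simp
  let v := hT.eigenvectorBasis hn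
  let ev := hT.eigenvalues hn
  have hev0 : ∀ i, 0 ≤ ev i := T.isPositive_adjoint_comp_self.nonneg_eigenvalues hn
  let s : Fin l → ℝ := fun i => Real.sqrt (ev i)
  have hss : ∀ i, s i * s i = ev i := fun i => Real.mul_self_sqrt (hev0 i)
  have hin : ∀ i j, inner ℝ (T (v i)) (T (v j)) = if i = j then ev j else 0 := by
    intro i j
    have h1 : (LinearMap.adjoint T ∘ₗ T) (v j) = ev j • v j := hT.apply_eigenvectorBasis hn j
    rw [← LinearMap.adjoint_inner_right]
    have h2 : LinearMap.adjoint T (T (v j)) = ev j • v j := h1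
    rw [h2, inner_smul_right, orthonormal_iff_ite.mp v.orthonormal i j]
    simp
  let w : Fin k → EuclideanSpace ℝ (Fin k) := fun i =>
    if hi : i.val < l then (s ⟨i, hi⟩)⁻¹ • T (v ⟨i, hi⟩) else 0
  let S : Set (Fin k) := {i | ∃ hi : i.val < l, s ⟨i, hi⟩ ≠ 0}
  have hw : Orthonormal ℝ (S.domRestrict w) := by
    rw [orthonormal_iff_ite]
    rintro ⟨i, hi, hi0⟩ ⟨j, hj, hj0⟩
    simp only [Set.domRestrict_apply, w, hi, hj, dif_pos, inner_smul_left, inner_smul_right, hin,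
      Subtype.mk.injEq, Fin.ext_iff]
    by_cases hij : i.val = j.val
    · have : (⟨i, hi⟩ : Fin l) = ⟨j, hj⟩ := Fin.ext hij
      simp only [hij, if_true, ← hss]
      simp
      field_simp
    · simp [hij]
  have hcard : Module.finrank ℝ (EuclideanSpace ℝ (Fin k)) = Fintype.card (Fin k) := by simp
  obtain ⟨b, hb⟩ := hw.exists_orthonormalBasis_extension_of_card_eq hcard
  have hTv : ∀ j : Fin l, T (v j) = s j • b (Fin.castLE h j) := by
    intro j
    by_cases hj : s j = 0
    · have : inner ℝ (T (v j)) (T (v j)) = (0 : ℝ) := by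
        rw [hin, if_pos rfl, ← hss, hj, mul_zero]
      rw [hj, zero_smul]
      exact inner_self_eq_zero.mp this
    · rw [hb (Fin.castLE h j) ⟨j.2, hj⟩]
      simp [w, smul_smul, hj]
  have hVV : (Matrix.of fun a j => v j a : Matrix (Fin l) (Fin l) ℝ)ᵀ *
      (Matrix.of fun a j => v j a) = 1 := by
    ext i j
    rw [Matrix.mul_apply, Matrix.one_apply, ← orthonormal_iff_ite.mp v.orthonormal i j]
    exact orth v i j
  refine ⟨Matrix.of fun a j => b (Fin.castLE h j) a, s, Matrix.of fun a j => v j a, ?_, hVV,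
    fun i => Real.sqrt_nonneg _, ?_, ?_⟩
  · ext i j
    have := orthonormal_iff_ite.mp b.orthonormal (Fin.castLE h i) (Fin.castLE h j)
    rw [Matrix.mul_apply, Matrix.one_apply]
    simp only [Fin.castLE_inj] at this
    rw [← this]
    exact orth b _ _
  · intro i j hij
    exact Real.sqrt_le_sqrt (hT.eigenvalues_antitone hn hij)
  · have key : M * (Matrix.of fun a j => v j a : Matrix (Fin l) (Fin l) ℝ) =
        (Matrix.of fun a j => b (Fin.castLE h j) a : Matrix (Fin k) (Fin l) ℝ) *
          Matrix.diagonal s := by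
      ext a j
      have := congrArg (fun z : EuclideanSpace ℝ (Fin k) => z a) (hTv j)
      rw [Matrix.mul_diagonal]
      simpa [T, Matrix.toLpLin_apply, Matrix.mulVec, dotProduct, Matrix.mul_apply, mul_comm]
        using this
    rw [← key, Matrix.mul_assoc, mul_eq_one_comm.mp hVV, Matrix.mul_one]

theorem exists_isSVD {k l : ℕ} (M : Matrix (Fin k) (Fin l) ℝ) : ∃ D : SVDData k l, IsSVD M D := by
  rcases le_total l k with h | h
  · have key : ∀ t, t = l → ∃ (U : Matrix (Fin k) (Fin t) ℝ) (s : Fin t → ℝ)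
        (V : Matrix (Fin l) (Fin t) ℝ), Uᵀ * U = 1 ∧ Vᵀ * V = 1 ∧ (∀ i, 0 ≤ s i) ∧
          Antitone s ∧ M = U * Matrix.diagonal s * Vᵀ := by
      rintro t rfl
      exact exists_svd_tall h M
    obtain ⟨U, s, V, h1, h2, h3, h4, h5⟩ := key (min k l) (min_eq_right h)
    exact ⟨⟨U, s, V⟩, ⟨h1, h2, h3, h4, h5⟩⟩
  · have key : ∀ t, t = k → ∃ (U : Matrix (Fin k) (Fin t) ℝ) (s : Fin t → ℝ)
        (V : Matrix (Fin l) (Fin t) ℝ), Uᵀ * U = 1 ∧ Vᵀ * V = 1 ∧ (∀ i, 0 ≤ s i) ∧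
          Antitone s ∧ M = U * Matrix.diagonal s * Vᵀ := by
      rintro t rfl
      obtain ⟨U, s, V, h1, h2, h3, h4, h5⟩ := exists_svd_tall h Mᵀ
      refine ⟨V, s, U, h2, h1, h3, h4, ?_⟩
      have := congrArg Matrix.transpose h5
      simpa [Matrix.transpose_mul, Matrix.mul_assoc] using this
    obtain ⟨U, s, V, h1, h2, h3, h4, h5⟩ := key (min k l) (min_eq_left h)
    exact ⟨⟨U, s, V⟩, ⟨h1, h2, h3, h4, h5⟩⟩

/-- A singular value decomposition of `M`. -/
def svd {k l : ℕ} (M : Matrix (Fin k) (Fin l) ℝ) : SVDData k l :=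
  Classical.choose (exists_isSVD M)

theorem svd_isSVD {k l : ℕ} (M : Matrix (Fin k) (Fin l) ℝ) : IsSVD M (svd M) :=
  Classical.choose_spec (exists_isSVD M)

/-! ### Computations on a random access machine over the real numbers, with a step count -/

/-- The value of a computation and the number of elementary steps that it takes. -/
structure Timed (α : Type) where
  val : α
  steps : ℕ

namespace Timed

instance : Monad Timed where
  pure a := ⟨a, 0⟩
  bind c f := ⟨(f c.val).val, c.steps + (f c.val).steps⟩

variable {α β : Type}

/-- `t` elementary steps. -/
def tick (t : ℕ) : Timed Unit := ⟨(), t⟩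

/-! The unit-cost operations: real arithmetic, zero test, array access, one random draw. -/

def radd (x y : ℝ) : Timed ℝ := ⟨x + y, 1⟩
def rsub (x y : ℝ) : Timed ℝ := ⟨x - y, 1⟩
def rmul (x y : ℝ) : Timed ℝ := ⟨x * y, 1⟩
def rdiv (x y : ℝ) : Timed ℝ := ⟨x / y, 1⟩
def rsqrt (x : ℝ) : Timed ℝ := ⟨Real.sqrt x, 1⟩
open Classical in
def isZero (x : ℝ) : Timed Bool := ⟨decide (x = 0), 1⟩
def load {N : ℕ} (a : Fin N → α) (i : Fin N) : Timed α := ⟨a i, 1⟩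
def load2 {N N' : ℕ} (a : Fin N → Fin N' → α) (i : Fin N) (j : Fin N') : Timed α := ⟨a i j, 1⟩
def store2 {N N' : ℕ} (a : Fin N → Fin N' → α) (i : Fin N) (j : Fin N') (x : α) :
    Timed (Fin N → Fin N' → α) :=
  ⟨Function.update a i (Function.update (a i) j x), 1⟩
def loadList (L : List α) (i : Fin L.length) : Timed α := ⟨L.get i, 1⟩
def pushList (L : List α) (x : α) : Timed (List α) := ⟨x :: L, 1⟩
def draw (x : α) : Timed α := ⟨x, 1⟩

/-- `for x in L do state := body state x`; one step of loop control for each iteration. -/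
def forEach : List β → α → (α → β → Timed α) → Timed α
  | [], a, _ => pure a
  | x :: L, a, body => do
      tick 1
      let b ← body a x
      forEach L b body

/-- `for i < N do array[i] := f i`; one step of loop control and one write for each iteration. -/
def tabulate {N : ℕ} (f : Fin N → Timed α) : Timed (Fin N → α) :=
  ⟨fun i => (f i).val, ∑ i, ((f i).steps + 2)⟩

/-- `for i < N do sum := sum + f i`; one step of loop control and one addition for each
iteration. -/
def sumLoop {N : ℕ} (f : Fin N → Timed ℝ) : Timed ℝ :=
  ⟨∑ i, (f i).val, ∑ i, ((f i).steps + 2)⟩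

/-- The SVD of a `k × l` matrix, the only operation used that cannot be carried out exactly by
finitely many arithmetic operations and square roots. It is charged `(k + l)³` steps. -/
def svdOp {k l : ℕ} (M : Fin k → Fin l → ℝ) : Timed (SVDData k l) :=
  ⟨svd (Matrix.of M), (k + l) ^ 3⟩

end Timed

open Timed

/-! ### The Björck–Golub algorithm -/

def dot {N : ℕ} (u v : Fin N → ℝ) : Timed ℝ :=
  sumLoop fun i => do
    let a ← load u i
    let b ← load v i
    rmul a b

/-- `v - t • u` -/
def subScaled {N : ℕ} (t : ℝ) (u v : Fin N → ℝ) : Timed (Fin N → ℝ) :=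
  tabulate fun i => do
    let a ← load v i
    let b ← load u i
    let c ← rmul t b
    rsub a c

/-- `d⁻¹ • v` -/
def divBy {N : ℕ} (d : ℝ) (v : Fin N → ℝ) : Timed (Fin N → ℝ) :=
  tabulate fun i => do
    let a ← load v i
    rdiv a d

/-- One column of the modified Gram–Schmidt process. The basis found so far is a list of pairs
`(q, x)` with `q = M x`; the `j`-th column of `M` is orthogonalized against it, and the result is
normalized and stored unless it is zero. -/
def orthStep {r n : ℕ} (M : Fin r → Fin n → ℝ) (basis : List ((Fin r → ℝ) × (Fin n → ℝ)))
    (j : Fin n) : Timed (List ((Fin r → ℝ) × (Fin n → ℝ))) := do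
  let v ← tabulate fun i => load2 M i j
  let c ← tabulate fun k => pure (if k = j then (1 : ℝ) else 0)
  let vc ← forEach basis (v, c) fun vc qx => do
    let t ← dot qx.1 vc.1
    let v' ← subScaled t qx.1 vc.1
    let c' ← subScaled t qx.2 vc.2
    pure (v', c')
  let s ← dot vc.1 vc.1
  let b ← isZero s
  if b then
    pure basis
  else do
    let d ← rsqrt s
    let q ← divBy d vc.1
    let x ← divBy d vc.2
    pushList basis (q, x)

/-- QR step: pairs `(q, x)` with `q = M x` whose first components form an orthonormal basis of the
column space of `M`. -/
def orthonormalize {r n : ℕ} (M : Fin r → Fin n → ℝ) :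
    Timed (List ((Fin r → ℝ) × (Fin n → ℝ))) :=
  forEach (List.finRange n) [] (orthStep M)

/-- The weights `X u_i`, where the columns of `X` are the second components of the basis. -/
def weights {r n t : ℕ} (basis : List ((Fin r → ℝ) × (Fin n → ℝ)))
    (U : Fin basis.length → Fin t → ℝ) : Timed (Fin t → Fin n → ℝ) :=
  tabulate fun i => tabulate fun a => sumLoop fun c => do
    let qx ← loadList basis c
    let e ← load qx.2 a
    let u ← load2 U c i
    rmul e u

/-- The Björck–Golub algorithm: orthonormal bases `Q` and `W` of the two column spaces, the SVD of
`Qᵀ W`, and from it the correlations and the weights. -/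
def bjorckGolub {r n l : ℕ} (A : Fin r → Fin n → ℝ) (B : Fin r → Fin l → ℝ) :
    Timed (Output n l) := do
  let Q ← orthonormalize A
  let W ← orthonormalize B
  let K ← tabulate fun a : Fin Q.length => tabulate fun b : Fin W.length => do
    let q ← loadList Q a
    let w ← loadList W b
    dot q.1 w.1
  let D ← svdOp K
  let wA ← weights Q D.U
  let wB ← weights W D.V
  pure ⟨min Q.length W.length, D.s, wA, wB⟩

/-! ### Approximate CCA with the Clarkson–Woodruff sparse embedding -/

/-- The number of rows `r = min(⌈243 ((n + l)² + (n + l)) / (ε² δ)⌉, m)` of the embedding. -/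
def sketchSize (m n l : ℕ) (ε δ : ℝ) : ℕ :=
  min ⌈243 * (((n : ℝ) + l) ^ 2 + ((n : ℝ) + l)) / (ε ^ 2 * δ)⌉₊ m

/-- The random choices: for every `i < m` an index of a standard basis vector of `ℝ^r`, and a sign.
They are independent and uniform, that is, the pair is uniform on the finite set `Tape m r`. -/
abbrev Tape (m r : ℕ) : Type := (Fin m → Fin r) × (Fin m → Bool)

/-- The law of the random choices. -/
def tapeLaw (m r : ℕ) : MeasureTheory.Measure (Tape m r) :=
  ProbabilityTheory.uniformOn Set.univ

def sign (b : Bool) : ℝ := if b then 1 else -1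

/-- The matrix `S`, whose `i`-th column is the standard basis vector with the drawn index. -/
def hashMatrix {m r : ℕ} (τ : Tape m r) : Matrix (Fin r) (Fin m) ℝ :=
  Matrix.of fun k i => if τ.1 i = k then 1 else 0

/-- The diagonal matrix `D` of random signs. -/
def signMatrix {m r : ℕ} (τ : Tape m r) : Matrix (Fin m) (Fin m) ℝ :=
  Matrix.diagonal fun i => sign (τ.2 i)

/-- `Â = S (D A)` -/
def sketch {m r n : ℕ} (τ : Tape m r) (A : Matrix (Fin m) (Fin n) ℝ) : Matrix (Fin r) (Fin n) ℝ :=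
  hashMatrix τ * (signMatrix τ * A)

/-- The number of nonzero entries. -/
def nnz {m n : ℕ} (A : Matrix (Fin m) (Fin n) ℝ) : ℕ :=
  {ij : Fin m × Fin n | A ij.1 ij.2 ≠ 0}.ncard

/-- `L` lists the nonzero entries of `A` as triples (row, column, value), in any order, each of
them once. This is how the algorithm receives its input matrices. -/
def IsSparseRep {m n : ℕ} (A : Matrix (Fin m) (Fin n) ℝ) (L : List (Fin m × Fin n × ℝ)) : Prop :=
  L.Nodup ∧ ∀ i j v, (i, j, v) ∈ L ↔ v = A i j ∧ v ≠ 0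

/-- Computation of `S (D A)` from the nonzero entries of `A`: the entry `v` at `(i, j)` is added,
with the `i`-th sign, to the entry of the result at `(h i, j)`. -/
def sketchSparse {m r n : ℕ} (h : Fin m → Fin r) (d : Fin m → ℝ)
    (L : List (Fin m × Fin n × ℝ)) : Timed (Fin r → Fin n → ℝ) := do
  let Z ← tabulate fun _ => tabulate fun _ => pure (0 : ℝ)
  forEach L Z fun M e => do
    let k ← load h e.1
    let s ← load d e.1
    let x ← rmul s e.2.2
    let y ← load2 M k e.2.1
    let z ← radd y x
    store2 M k e.2.1 z

/-- The whole algorithm, with the Björck–Golub algorithm as the exact CCA solver for the reduced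
pair. The first line accounts for the nine operations that compute the sketch size. -/
def fastCCA {m n l : ℕ} (ε δ : ℝ) (LA : List (Fin m × Fin n × ℝ)) (LB : List (Fin m × Fin l × ℝ))
    (τ : Tape m (sketchSize m n l ε δ)) : Timed (Output n l) := do
  tick 9
  let h ← tabulate fun i => draw (τ.1 i)
  let d ← tabulate fun i => draw (sign (τ.2 i))
  let A' ← sketchSparse h d LA
  let B' ← sketchSparse h d LB
  bjorckGolub A' B'

end CCA

end

/-! Part 1 separates into a probabilistic and a deterministic statement. Let `u` be an orthonormal
basis of the column space of `[A; B]`, of size ω. Off the diagonal, the error of the sketch on an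
inner product is a sum of random signs times collision indicators. Squaring and averaging leaves
only pairs of indices that coincide up to a swap, and a collision has probability 1/r. Hence r times
the mean squared error on `(x, y)` is at most |x|²|y|² + ⟨x, y⟩² (`sum_sq_sketchError_le`), and
summing over the basis gives ω² + ω. By Markov, outside an event of probability δ the Gram error
matrix has Frobenius norm at most e = ε/√243. This bounds the error of every inner product in the
column space by e times the product of norms (`abs_sketchError_le`).

Deterministically, such a near isometry has the same kernels, hence the same ranks, and it moves
each canonical correlation by at most 2e (`abs_cosine_sub_cosine_le`). The latter is a min-max
argument that must cover every choice of maximizers. First-order optimality makes `A x_i` orthogonal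
to `B y_j` for i ≠ j (`IsCanonicalSystem.cross`), so the i-th correlation is bounded below on spans
of leading vectors and above on orthogonal complements of leading vectors. A dimension count yields
one vector to which both bounds apply, one for each of the two systems
(`IsCanonicalSystem.exists_compare`).

For part 2, Gram–Schmidt in exact arithmetic carries preimages along with the basis vectors, and the
SVD of `Qᵀ W` diagonalizes the pairing of the two column spaces, so the recursive maximality follows
from Cauchy–Schwarz and Bessel (`isExactCCA_of_svd`). The dominant cost is n²r with r of order
n²/(ε²δ). -/

open scoped Matrix

noncomputable section

namespace CCA

/-! ### Invariants and cost bounds for timed loops -/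

namespace Timed

variable {α β : Type}

@[simp] theorem val_bind (c : Timed α) (f : α → Timed β) : (c >>= f).val = (f c.val).val := rfl
@[simp] theorem steps_bind (c : Timed α) (f : α → Timed β) :
    (c >>= f).steps = c.steps + (f c.val).steps := rfl
@[simp] theorem val_pure (a : α) : (pure a : Timed α).val = a := rfl
@[simp] theorem steps_pure (a : α) : (pure a : Timed α).steps = 0 := rfl

/-- Loop invariant rule: the list argument of `P` is the part of the input still to be processed. -/
theorem forEach_induct (P : α → List β → Prop) {body : α → β → Timed α}
    (step : ∀ a x L, P a (x :: L) → P (body a x).val L) :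
    ∀ (L : List β) (a : α), P a L → P (forEach L a body).val []
  | [], _, h => h
  | x :: L, a, h => forEach_induct P step L _ (step a x L h)

theorem forEach_steps_le (P : α → List β → Prop) {body : α → β → Timed α} {c : ℕ}
    (step : ∀ a x L, P a (x :: L) → P (body a x).val L)
    (cost : ∀ a x L, P a (x :: L) → (body a x).steps ≤ c) :
    ∀ (L : List β) (a : α), P a L → (forEach L a body).steps ≤ L.length * (c + 1)
  | [], _, _ => by simp [forEach]
  | x :: L, a, h => by
    have h1 := forEach_steps_le P step cost L _ (step a x L h)
    have h2 := cost a x L h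
    simp only [forEach, steps_bind, tick, List.length_cons]
    linarith

theorem tabulate_steps_le {N : ℕ} {f : Fin N → Timed α} {c : ℕ} (h : ∀ i, (f i).steps ≤ c) :
    (tabulate f).steps ≤ N * (c + 2) := by
  have := Finset.sum_le_sum fun i (_ : i ∈ Finset.univ) => Nat.add_le_add_right (h i) 2
  simpa [tabulate] using this

theorem sumLoop_steps_le {N : ℕ} {f : Fin N → Timed ℝ} {c : ℕ} (h : ∀ i, (f i).steps ≤ c) :
    (sumLoop f).steps ≤ N * (c + 2) := by
  have := Finset.sum_le_sum fun i (_ : i ∈ Finset.univ) => Nat.add_le_add_right (h i) 2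
  simpa [sumLoop] using this

end Timed

open Timed

/-! ### Euclidean vectors and cosines -/

section Vectors

theorem dot_eq_inner {m : ℕ} (u v : Fin m → ℝ) :
    u ⬝ᵥ v = inner ℝ (WithLp.toLp 2 u : EuclideanSpace ℝ (Fin m)) (WithLp.toLp 2 v) := by
  simp [PiLp.inner_apply, dotProduct, mul_comm]

theorem l2norm_nonneg {m : ℕ} (u : Fin m → ℝ) : 0 ≤ l2norm u := norm_nonneg _

theorem l2norm_sq {m : ℕ} (u : Fin m → ℝ) : l2norm u ^ 2 = u ⬝ᵥ u := by
  rw [dot_eq_inner, real_inner_self_eq_norm_sq, l2norm]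

theorem abs_dot_le {m : ℕ} (u v : Fin m → ℝ) : |u ⬝ᵥ v| ≤ l2norm u * l2norm v := by
  rw [dot_eq_inner]
  exact abs_real_inner_le_norm _ _

theorem l2norm_pos {m : ℕ} {u : Fin m → ℝ} (h : u ≠ 0) : 0 < l2norm u := by
  refine norm_pos_iff.mpr fun h0 => h ?_
  simpa using h0

theorem l2norm_eq_zero {m : ℕ} {u : Fin m → ℝ} : l2norm u = 0 ↔ u = 0 :=
  ⟨fun h => by_contra fun h0 => (l2norm_pos h0).ne' h, fun h => by simp [h, l2norm]⟩

theorem dot_self_pos {m : ℕ} {u : Fin m → ℝ} (h : u ≠ 0) : 0 < u ⬝ᵥ u := by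
  rw [← l2norm_sq]
  exact pow_pos (l2norm_pos h) 2

theorem l2norm_le_iff {m m' : ℕ} (u : Fin m → ℝ) (v : Fin m' → ℝ) :
    l2norm u ≤ l2norm v ↔ u ⬝ᵥ u ≤ v ⬝ᵥ v := by
  rw [← l2norm_sq, ← l2norm_sq]
  exact (sq_le_sq₀ (l2norm_nonneg _) (l2norm_nonneg _)).symm

theorem l2norm_eq_one {m : ℕ} {u : Fin m → ℝ} (h : u ⬝ᵥ u = 1) : l2norm u = 1 := by
  rw [← l2norm_sq] at h
  exact (pow_eq_one_iff_of_nonneg (l2norm_nonneg u) two_ne_zero).mp h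

theorem cosine_mul {m : ℕ} {u v : Fin m → ℝ} (hu : u ≠ 0) (hv : v ≠ 0) :
    cosine u v * (l2norm u * l2norm v) = |u ⬝ᵥ v| :=
  div_mul_cancel₀ _ (mul_pos (l2norm_pos hu) (l2norm_pos hv)).ne'

theorem cosine_nonneg {m : ℕ} (u v : Fin m → ℝ) : 0 ≤ cosine u v :=
  div_nonneg (abs_nonneg _) (mul_nonneg (l2norm_nonneg u) (l2norm_nonneg v))

theorem cosine_le_one {m : ℕ} (u v : Fin m → ℝ) : cosine u v ≤ 1 :=
  div_le_one_of_le₀ (abs_dot_le u v) (mul_nonneg (l2norm_nonneg u) (l2norm_nonneg v))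

theorem cosine_comm {m : ℕ} (u v : Fin m → ℝ) : cosine u v = cosine v u := by
  rw [cosine, cosine, dotProduct_comm, mul_comm (l2norm u)]

theorem dot_sum_sum {m k : ℕ} {f g : Fin k → Fin m → ℝ} (h : ∀ i j, i ≠ j → f i ⬝ᵥ g j = 0)
    (c d : Fin k → ℝ) :
    (∑ i, c i • f i) ⬝ᵥ (∑ j, d j • g j) = ∑ i, c i * d i * (f i ⬝ᵥ g i) := by
  simp only [sum_dotProduct, dotProduct_sum, smul_dotProduct, dotProduct_smul, smul_eq_mul]
  refine Finset.sum_congr rfl fun i _ => ?_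
  rw [Finset.sum_eq_single i (fun j _ hj => by rw [h j i hj]; simp) (by simp)]
  ring

/-- Bessel's inequality. -/
theorem sum_sq_dot_le {m k : ℕ} {f : Fin k → Fin m → ℝ}
    (h : ∀ i j, f i ⬝ᵥ f j = if i = j then 1 else 0) (u : Fin m → ℝ) :
    ∑ i, (u ⬝ᵥ f i) ^ 2 ≤ u ⬝ᵥ u := by
  have h1 : 0 ≤ (u - ∑ i, (u ⬝ᵥ f i) • f i) ⬝ᵥ (u - ∑ i, (u ⬝ᵥ f i) • f i) := by
    rw [← l2norm_sq]; positivity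
  have h2 : u ⬝ᵥ (∑ i, (u ⬝ᵥ f i) • f i) = ∑ i, (u ⬝ᵥ f i) ^ 2 := by
    simp [dotProduct_sum, dotProduct_smul, sq]
  have h3 : (∑ i, (u ⬝ᵥ f i) • f i) ⬝ᵥ u = ∑ i, (u ⬝ᵥ f i) ^ 2 := by rw [dotProduct_comm, h2]
  rw [sub_dotProduct, dotProduct_sub, dotProduct_sub, h3, h2,
    dot_sum_sum (fun i j hij => by rw [h, if_neg hij])] at h1
  simp only [h, if_true, mul_one, ← sq] at h1
  linarith

end Vectors

/-! ### Correctness of modified Gram–Schmidt -/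

section GramSchmidt

variable {r n : ℕ}

@[simp] theorem dot_val {N : ℕ} (u v : Fin N → ℝ) : (dot u v).val = u ⬝ᵥ v := rfl

@[simp] theorem subScaled_val {N : ℕ} (t : ℝ) (u v : Fin N → ℝ) :
    (subScaled t u v).val = v - t • u := rfl

@[simp] theorem divBy_val {N : ℕ} (d : ℝ) (v : Fin N → ℝ) : (divBy d v).val = d⁻¹ • v := by
  ext i
  simp [divBy, tabulate, load, rdiv, div_eq_inv_mul]

theorem dot_steps {N : ℕ} (u v : Fin N → ℝ) : (dot u v).steps = N * 5 := by
  simp [dot, sumLoop, load, rmul]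

theorem subScaled_steps {N : ℕ} (t : ℝ) (u v : Fin N → ℝ) : (subScaled t u v).steps = N * 6 := by
  simp [subScaled, tabulate, load, rmul, rsub]

theorem divBy_steps {N : ℕ} (d : ℝ) (v : Fin N → ℝ) : (divBy d v).steps = N * 4 := by
  simp [divBy, tabulate, load, rdiv]

/-- The linear span of the first components of `basis`. -/
def basisSpan (basis : List ((Fin r → ℝ) × (Fin n → ℝ))) : Submodule ℝ (Fin r → ℝ) :=
  Submodule.span ℝ (Prod.fst '' {p | p ∈ basis})

/-- The pairs `(q, x)` in `basis` satisfy `q = M x`, and the vectors `q` are orthonormal. -/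
structure IsOrthoBasis (M : Matrix (Fin r) (Fin n) ℝ)
    (basis : List ((Fin r → ℝ) × (Fin n → ℝ))) : Prop where
  eq_mulVec : ∀ p ∈ basis, p.1 = M *ᵥ p.2
  unit : ∀ p ∈ basis, p.1 ⬝ᵥ p.1 = 1
  orth : basis.Pairwise fun p q => p.1 ⬝ᵥ q.1 = 0

theorem IsOrthoBasis.dot_eq_zero {M : Matrix (Fin r) (Fin n) ℝ}
    {basis : List ((Fin r → ℝ) × (Fin n → ℝ))} (hb : IsOrthoBasis M basis)
    {p q : (Fin r → ℝ) × (Fin n → ℝ)} (hp : p ∈ basis) (hq : q ∈ basis) (hpq : p ≠ q) :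
    p.1 ⬝ᵥ q.1 = 0 := by
  have : Std.Symm fun p q : (Fin r → ℝ) × (Fin n → ℝ) => p.1 ⬝ᵥ q.1 = 0 :=
    ⟨fun p q h => by rw [dotProduct_comm, h]⟩
  exact hb.orth.forall hp hq hpq

/-- The loop body of the Gram–Schmidt process. -/
def projectStep (vc : (Fin r → ℝ) × (Fin n → ℝ)) (qx : (Fin r → ℝ) × (Fin n → ℝ)) :
    Timed ((Fin r → ℝ) × (Fin n → ℝ)) := do
  let t ← dot qx.1 vc.1
  let v' ← subScaled t qx.1 vc.1
  let c' ← subScaled t qx.2 vc.2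
  pure (v', c')

/-- The projection of a column onto the orthogonal complement of `basis`, with its coordinates. -/
def residual (M : Matrix (Fin r) (Fin n) ℝ) (basis : List ((Fin r → ℝ) × (Fin n → ℝ)))
    (j : Fin n) : Timed ((Fin r → ℝ) × (Fin n → ℝ)) :=
  forEach basis (fun i => M i j, fun k => if k = j then (1 : ℝ) else 0) projectStep

theorem orthStep_val (M : Matrix (Fin r) (Fin n) ℝ) (basis : List ((Fin r → ℝ) × (Fin n → ℝ)))
    (j : Fin n) :
    (orthStep M basis j).val =
      if (residual M basis j).val.1 ⬝ᵥ (residual M basis j).val.1 = 0 then basis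
      else ((Real.sqrt ((residual M basis j).val.1 ⬝ᵥ (residual M basis j).val.1))⁻¹ •
          (residual M basis j).val.1,
        (Real.sqrt ((residual M basis j).val.1 ⬝ᵥ (residual M basis j).val.1))⁻¹ •
          (residual M basis j).val.2) :: basis := by
  by_cases h : (residual M basis j).val.1 ⬝ᵥ (residual M basis j).val.1 = 0
  · have h' := h
    unfold residual projectStep at h'
    rw [if_pos h]
    simp [orthStep, isZero, tabulate, load2, h']
  · have h' := h
    unfold residual projectStep at h'
    rw [if_neg h]
    unfold residual projectStep
    simp [orthStep, isZero, tabulate, load2, h', pushList, rsqrt]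

theorem residual_spec (M : Matrix (Fin r) (Fin n) ℝ) {basis : List ((Fin r → ℝ) × (Fin n → ℝ))}
    (hb : IsOrthoBasis M basis) (j : Fin n) :
    (residual M basis j).val.1 = M *ᵥ (residual M basis j).val.2 ∧
      (fun i => M i j) - (residual M basis j).val.1 ∈ basisSpan basis ∧
      ∀ p ∈ basis, p.1 ⬝ᵥ (residual M basis j).val.1 = 0 := by
  -- The coefficient is computed from the current vector, not from the original column.
  -- Orthogonality to the elements already processed survives because the basis is orthonormal, so
  -- the invariant claims it exactly for elements outside the remaining list.
  have key := forEach_induct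
    (fun (vc : (Fin r → ℝ) × (Fin n → ℝ)) (L : List ((Fin r → ℝ) × (Fin n → ℝ))) =>
      L ⊆ basis ∧ vc.1 = M *ᵥ vc.2 ∧ (fun i => M i j) - vc.1 ∈ basisSpan basis ∧
        ∀ p ∈ basis, p ∉ L → p.1 ⬝ᵥ vc.1 = 0) (body := projectStep) ?_ basis
    (fun i => M i j, fun k => if k = j then (1 : ℝ) else 0) ?_
  · exact ⟨key.2.1, key.2.2.1, fun p hp => key.2.2.2 p hp (by simp)⟩
  · rintro ⟨v, c⟩ x L ⟨hL, hv, hs, ho⟩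
    have hx : x ∈ basis := hL (by simp)
    refine ⟨fun y hy => hL (by simp [hy]), ?_, ?_, ?_⟩
    · simp only at hv
      simp only [projectStep, val_bind, val_pure, subScaled_val, dot_val, Matrix.mulVec_sub,
        Matrix.mulVec_smul]
      rw [← hb.eq_mulVec x hx, ← hv]
    · simp only [projectStep, val_bind, val_pure, subScaled_val, dot_val, sub_sub_eq_add_sub] at hs ⊢
      rw [add_sub_right_comm]
      exact add_mem hs (Submodule.smul_mem _ _ (Submodule.subset_span ⟨x, hx, rfl⟩))
    · intro p hp hpL
      simp only [projectStep, val_bind, val_pure, subScaled_val, dot_val, dotProduct_sub,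
        dotProduct_smul, smul_eq_mul]
      by_cases hpx : p = x
      · rw [hpx, hb.unit x hx, mul_one, sub_self]
      · rw [ho p hp (by simp [hpx, hpL])]
        rw [hb.dot_eq_zero hp hx hpx, mul_zero, sub_zero]
  · refine ⟨fun _ h => h, ?_, by simp, fun p hp hp' => absurd hp hp'⟩
    ext i
    simp [Matrix.mulVec, dotProduct]

theorem orthonormalize_spec (M : Matrix (Fin r) (Fin n) ℝ) :
    IsOrthoBasis M (orthonormalize M).val ∧
      ∀ j, (fun i => M i j) ∈ basisSpan (orthonormalize M).val := by
  have key := forEach_induct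
    (fun (basis : List ((Fin r → ℝ) × (Fin n → ℝ))) (L : List (Fin n)) =>
      IsOrthoBasis M basis ∧ ∀ j, j ∉ L → (fun i => M i j) ∈ basisSpan basis)
    (body := orthStep M) ?_ (List.finRange n) [] ?_
  · exact ⟨key.1, fun j => key.2 j (by simp)⟩
  · rintro basis j L ⟨hb, hs⟩
    obtain ⟨h1, h2, h3⟩ := residual_spec M hb j
    rw [orthStep_val]
    set v := (residual M basis j).val.1
    set c := (residual M basis j).val.2
    have hcol : ∀ j', j' ∉ L → j' = j ∨ j' ∉ j :: L := fun j' h => by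
      by_cases hj : j' = j <;> simp [hj, h]
    split_ifs with h
    -- A zero residual means that the column already lies in the span, so it may be skipped.
    · refine ⟨hb, fun j' hj' => (hcol j' hj').elim ?_ (hs j')⟩
      rintro rfl
      rwa [dotProduct_self_eq_zero.mp h, sub_zero] at h2
    · have hpos : 0 < v ⬝ᵥ v := dot_self_pos fun h0 => h (by simp [h0])
      have hsq := Real.mul_self_sqrt hpos.le
      have hne : Real.sqrt (v ⬝ᵥ v) ≠ 0 := (Real.sqrt_pos.mpr hpos).ne'
      have hmono : basisSpan basis ≤
          basisSpan ((((Real.sqrt (v ⬝ᵥ v))⁻¹ • v, (Real.sqrt (v ⬝ᵥ v))⁻¹ • c)) :: basis) :=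
        Submodule.span_mono (Set.image_mono fun p hp => by simp_all)
      refine ⟨⟨?_, ?_, ?_⟩, fun j' hj' => (hcol j' hj').elim ?_ fun h => hmono (hs j' h)⟩
      · rintro p (_ | ⟨_, hp⟩)
        · simp only [Matrix.mulVec_smul, ← h1]
        · exact hb.eq_mulVec p hp
      · rintro p (_ | ⟨_, hp⟩)
        · simp only [smul_dotProduct, dotProduct_smul, smul_eq_mul]
          field_simp
          rw [sq, hsq]
        · exact hb.unit p hp
      · refine List.pairwise_cons.mpr ⟨fun p hp => ?_, hb.orth⟩
        rw [smul_dotProduct, dotProduct_comm v p.1, h3 p hp, smul_zero]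
      · rintro rfl
        rw [← sub_add_cancel (fun i => M i j') v]
        refine add_mem (hmono h2) ?_
        have : Real.sqrt (v ⬝ᵥ v) • ((Real.sqrt (v ⬝ᵥ v))⁻¹ • v) ∈
            basisSpan ((((Real.sqrt (v ⬝ᵥ v))⁻¹ • v, (Real.sqrt (v ⬝ᵥ v))⁻¹ • c)) :: basis) :=
          Submodule.smul_mem _ _ (Submodule.subset_span
            ⟨((Real.sqrt (v ⬝ᵥ v))⁻¹ • v, (Real.sqrt (v ⬝ᵥ v))⁻¹ • c), List.mem_cons_self, rfl⟩)
        rwa [smul_smul, mul_inv_cancel₀ hne, one_smul] at this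
  · exact ⟨⟨by simp, by simp, by simp⟩, fun j hj => absurd (List.mem_finRange j) hj⟩

end GramSchmidt

/-! ### Correctness of the Björck–Golub algorithm -/

section BjorckGolub

variable {r n l : ℕ}

theorem IsOrthoBasis.dot_get {M : Matrix (Fin r) (Fin n) ℝ}
    {basis : List ((Fin r → ℝ) × (Fin n → ℝ))} (hb : IsOrthoBasis M basis)
    (a b : Fin basis.length) :
    (basis.get a).1 ⬝ᵥ (basis.get b).1 = if a = b then 1 else 0 := by
  have h := List.pairwise_iff_get.mp hb.orth
  split_ifs with hab
  · rw [hab, hb.unit _ (List.get_mem _ _)]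
  · rcases lt_or_gt_of_ne hab with h1 | h1
    · exact h a b h1
    · rw [dotProduct_comm]
      exact h b a h1

theorem basisSpan_eq (basis : List ((Fin r → ℝ) × (Fin n → ℝ))) :
    basisSpan basis = Submodule.span ℝ (Set.range fun a => (basis.get a).1) := by
  rw [basisSpan]
  congr 1
  ext q
  simp only [Set.mem_image, Set.mem_ofPred_eq, Set.mem_range, List.mem_iff_get]
  constructor
  · rintro ⟨p, ⟨a, rfl⟩, rfl⟩
    exact ⟨a, rfl⟩
  · rintro ⟨a, rfl⟩
    exact ⟨_, ⟨a, rfl⟩, rfl⟩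

theorem linearIndependent_of_dot {m k : ℕ} {f : Fin k → Fin m → ℝ}
    (h : ∀ i j, f i ⬝ᵥ f j = if i = j then 1 else 0) : LinearIndependent ℝ f := by
  rw [Fintype.linearIndependent_iff]
  intro g hg i
  have := congrArg (fun z => z ⬝ᵥ f i) hg
  simpa [sum_dotProduct, h] using this

variable (M : Matrix (Fin r) (Fin n) ℝ)

theorem basisSpan_orthonormalize :
    basisSpan (orthonormalize M).val = LinearMap.range M.mulVecLin := by
  obtain ⟨hb, hs⟩ := orthonormalize_spec M
  apply le_antisymm
  · rw [basisSpan, Submodule.span_le]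
    rintro _ ⟨p, hp, rfl⟩
    exact ⟨p.2, by rw [Matrix.mulVecLin_apply, hb.eq_mulVec p hp]⟩
  · rw [Matrix.range_mulVecLin, Submodule.span_le]
    rintro _ ⟨j, rfl⟩
    exact hs j

/-- The list is an orthonormal basis of the column space. This gives the output its required number
of correlations. -/
theorem length_orthonormalize : (orthonormalize M).val.length = M.rank := by
  rw [Matrix.rank, ← basisSpan_orthonormalize, basisSpan_eq,
    finrank_span_eq_card (linearIndependent_of_dot (orthonormalize_spec M).1.dot_get),
    Fintype.card_fin]

theorem mulVec_eq_sum_orthonormalize (x : Fin n → ℝ) :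
    M *ᵥ x = ∑ a, ((M *ᵥ x) ⬝ᵥ ((orthonormalize M).val.get a).1) •
      ((orthonormalize M).val.get a).1 := by
  have h : M *ᵥ x ∈ basisSpan (orthonormalize M).val := by
    rw [basisSpan_orthonormalize]
    exact ⟨x, rfl⟩
  rw [basisSpan_eq, Submodule.mem_span_range_iff_exists_fun] at h
  obtain ⟨c, hc⟩ := h
  rw [← hc]
  refine Finset.sum_congr rfl fun a _ => ?_
  rw [sum_dotProduct]
  simp only [smul_dotProduct, (orthonormalize_spec M).1.dot_get]
  simp

/-- Since each basis vector is stored with a preimage under `M`, weights are obtained without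
inverting a triangular factor. -/
theorem mulVec_weights {t : ℕ} {basis : List ((Fin r → ℝ) × (Fin n → ℝ))}
    (hb : IsOrthoBasis M basis) (U : Fin basis.length → Fin t → ℝ) (i : Fin t) :
    M *ᵥ ((weights basis U).val i) = ∑ c, U c i • (basis.get c).1 := by
  have h : (weights basis U).val i = ∑ c, U c i • (basis.get c).2 := by
    ext a
    simp [weights, tabulate, sumLoop, loadList, load, load2, rmul, mul_comm]
  rw [h, Matrix.mulVec_sum]
  refine Finset.sum_congr rfl fun c _ => ?_
  rw [Matrix.mulVec_smul, hb.eq_mulVec _ (List.get_mem _ _)]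

theorem dot_combination {k t : ℕ} {f : Fin k → Fin r → ℝ}
    (h : ∀ i j, f i ⬝ᵥ f j = if i = j then 1 else 0) (U : Matrix (Fin k) (Fin t) ℝ)
    (hU : Uᵀ * U = 1) (i j : Fin t) :
    (∑ c, U c i • f c) ⬝ᵥ (∑ c, U c j • f c) = if i = j then 1 else 0 := by
  rw [dot_sum_sum fun i j hij => by rw [h, if_neg hij]]
  have := congrFun (congrFun hU i) j
  rw [Matrix.one_apply, Matrix.mul_apply] at this
  rw [← this]
  simp [h]

/-- A singular value decomposition of the matrix of inner products of two orthonormal bases is an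
exact canonical correlation analysis. -/
theorem isExactCCA_of_svd {A : Matrix (Fin r) (Fin n) ℝ} {B : Matrix (Fin r) (Fin l) ℝ}
    {k k' : ℕ} {f : Fin k → Fin r → ℝ} {g : Fin k' → Fin r → ℝ}
    (hf : ∀ i j, f i ⬝ᵥ f j = if i = j then 1 else 0)
    (hg : ∀ i j, g i ⬝ᵥ g j = if i = j then 1 else 0)
    (hA : ∀ x, A *ᵥ x = ∑ a, ((A *ᵥ x) ⬝ᵥ f a) • f a)
    (hB : ∀ y, B *ᵥ y = ∑ b, ((B *ᵥ y) ⬝ᵥ g b) • g b)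
    (hk : k = A.rank) (hk' : k' = B.rank) {K : Matrix (Fin k) (Fin k') ℝ}
    (hK : ∀ a b, K a b = f a ⬝ᵥ g b) {D : SVDData k k'} (hD : IsSVD K D)
    {wA : Fin (min k k') → Fin n → ℝ} {wB : Fin (min k k') → Fin l → ℝ}
    (hwA : ∀ i, A *ᵥ wA i = ∑ c, D.U c i • f c) (hwB : ∀ i, B *ᵥ wB i = ∑ c, D.V c i • g c) :
    IsExactCCA A B ⟨min k k', D.s, wA, wB⟩ := by
  have oA : ∀ i j, (A *ᵥ wA i) ⬝ᵥ (A *ᵥ wA j) = if i = j then 1 else 0 := fun i j => by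
    rw [hwA, hwA, dot_combination hf _ hD.orthU]
  have oB : ∀ i j, (B *ᵥ wB i) ⬝ᵥ (B *ᵥ wB j) = if i = j then 1 else 0 := fun i j => by
    rw [hwB, hwB, dot_combination hg _ hD.orthV]
  have nA : ∀ i, l2norm (A *ᵥ wA i) = 1 := fun i => l2norm_eq_one (by simp [oA])
  have nB : ∀ i, l2norm (B *ᵥ wB i) = 1 := fun i => l2norm_eq_one (by simp [oB])
  -- The SVD diagonalizes the pairing of the two column spaces; everything below is read off from
  -- this formula.
  have expand : ∀ x y, (A *ᵥ x) ⬝ᵥ (B *ᵥ y) =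
      ∑ j, D.s j * (((A *ᵥ x) ⬝ᵥ (A *ᵥ wA j)) * ((B *ᵥ y) ⬝ᵥ (B *ᵥ wB j))) := by
    intro x y
    have h1 : (A *ᵥ x) ⬝ᵥ (B *ᵥ y) = (fun a => (A *ᵥ x) ⬝ᵥ f a) ⬝ᵥ
        (K *ᵥ fun b => (B *ᵥ y) ⬝ᵥ g b) := by
      conv_lhs => rw [hA x, hB y]
      simp only [sum_dotProduct, dotProduct_sum, smul_dotProduct, dotProduct_smul, smul_eq_mul,
        Finset.mul_sum]
      rw [Finset.sum_comm]
      change _ = ∑ a, ((A *ᵥ x) ⬝ᵥ f a) * ∑ b, K a b * ((B *ᵥ y) ⬝ᵥ g b)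
      refine Finset.sum_congr rfl fun a _ => ?_
      rw [Finset.mul_sum]
      refine Finset.sum_congr rfl fun b _ => ?_
      rw [hK]
      ring
    have h2 : ∀ j, (A *ᵥ x) ⬝ᵥ (A *ᵥ wA j) = (D.Uᵀ *ᵥ fun a => (A *ᵥ x) ⬝ᵥ f a) j := fun j => by
      rw [hwA, dotProduct_sum]
      simp only [dotProduct_smul, smul_eq_mul]
      rfl
    have h3 : ∀ j, (B *ᵥ y) ⬝ᵥ (B *ᵥ wB j) = (D.Vᵀ *ᵥ fun a => (B *ᵥ y) ⬝ᵥ g a) j := fun j => by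
      rw [hwB, dotProduct_sum]
      simp only [dotProduct_smul, smul_eq_mul]
      rfl
    rw [h1, hD.eq, ← Matrix.mulVec_mulVec, ← Matrix.mulVec_mulVec, Matrix.dotProduct_mulVec,
      ← Matrix.mulVec_transpose]
    simp only [h2, h3]
    rw [dotProduct]
    refine Finset.sum_congr rfl fun j _ => ?_
    rw [Matrix.mulVec_diagonal]
    ring
  have hdiag : ∀ i, (A *ᵥ wA i) ⬝ᵥ (B *ᵥ wB i) = D.s i := fun i => by
    rw [expand]
    simp [oA, oB]
  have hcos : ∀ i, cosine (A *ᵥ wA i) (B *ᵥ wB i) = D.s i := fun i => by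
    rw [cosine, hdiag, nA, nB, mul_one, div_one, abs_of_nonneg (hD.nonneg i)]
  refine ⟨congrArg₂ min hk hk', fun i => ⟨⟨?_, fun j hj => ?_⟩, ⟨?_, fun j hj => ?_⟩, ?_⟩, nA, nB,
    fun i => (hcos i).symm⟩
  · intro h
    have := nA i
    simp [h, l2norm] at this
  · rw [oA, if_neg hj.ne']
  · intro h
    have := nB i
    simp [h, l2norm] at this
  · rw [oB, if_neg hj.ne']
  · rintro x ⟨hx, hx'⟩ y ⟨hy, hy'⟩
    simp only at hx' hy' ⊢
    rw [hcos, cosine, div_le_iff₀ (mul_pos (l2norm_pos hx) (l2norm_pos hy)), expand]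
    -- Admissibility kills the terms with `j < i`, and the others have `D.s j ≤ D.s i`.
    -- Cauchy–Schwarz and Bessel then bound the remaining sum by the product of the norms.
    have hb : ∀ j, |D.s j * (((A *ᵥ x) ⬝ᵥ (A *ᵥ wA j)) * ((B *ᵥ y) ⬝ᵥ (B *ᵥ wB j)))| ≤
        D.s i * (|(A *ᵥ x) ⬝ᵥ (A *ᵥ wA j)| * |(B *ᵥ y) ⬝ᵥ (B *ᵥ wB j)|) := by
      intro j
      rcases lt_or_ge j i with hj | hj
      · rw [hx' j hj]
        simp
      · rw [abs_mul, abs_mul, abs_of_nonneg (hD.nonneg j)]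
        exact mul_le_mul_of_nonneg_right (hD.anti hj) (by positivity)
    refine (Finset.abs_sum_le_sum_abs _ _).trans ((Finset.sum_le_sum fun j _ => hb j).trans ?_)
    rw [← Finset.mul_sum]
    refine mul_le_mul_of_nonneg_left ?_ (hD.nonneg i)
    refine (Real.sum_mul_le_sqrt_mul_sqrt _ _ _).trans ?_
    simp only [sq_abs]
    refine mul_le_mul ?_ ?_ (Real.sqrt_nonneg _) (l2norm_nonneg _)
    · rw [Real.sqrt_le_left (l2norm_nonneg _), l2norm_sq]
      exact sum_sq_dot_le oA _
    · rw [Real.sqrt_le_left (l2norm_nonneg _), l2norm_sq]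
      exact sum_sq_dot_le oB _

/-- Besides correctness of the last step, this shows that canonical systems exist for every pair of
matrices. -/
theorem bjorckGolub_isExactCCA (A : Matrix (Fin r) (Fin n) ℝ) (B : Matrix (Fin r) (Fin l) ℝ) :
    IsExactCCA A B (bjorckGolub A B).val :=
  isExactCCA_of_svd (orthonormalize_spec A).1.dot_get (orthonormalize_spec B).1.dot_get
    (mulVec_eq_sum_orthonormalize A) (mulVec_eq_sum_orthonormalize B)
    (length_orthonormalize A) (length_orthonormalize B) (fun _ _ => rfl) (svd_isSVD _)
    (mulVec_weights A (orthonormalize_spec A).1 _) (mulVec_weights B (orthonormalize_spec B).1 _)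

end BjorckGolub

/-! ### Step count of the Björck–Golub algorithm -/

section Steps

variable {r n l : ℕ}

theorem orthStep_length_le (M : Fin r → Fin n → ℝ) (basis : List ((Fin r → ℝ) × (Fin n → ℝ)))
    (j : Fin n) : (orthStep M basis j).val.length ≤ basis.length + 1 := by
  rw [orthStep_val M]
  split_ifs <;> simp

theorem residual_steps_le (M : Matrix (Fin r) (Fin n) ℝ)
    (basis : List ((Fin r → ℝ) × (Fin n → ℝ))) (j : Fin n) :
    (residual M basis j).steps ≤ basis.length * (r * 11 + n * 6 + 1) := by
  refine forEach_steps_le (fun _ _ => True) (fun _ _ _ _ => trivial) (fun _ _ _ _ => ?_) _ _ trivial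
  simp only [projectStep, steps_bind, steps_pure, dot_steps, subScaled_steps]
  omega

theorem orthStep_steps_le (M : Matrix (Fin r) (Fin n) ℝ)
    (basis : List ((Fin r → ℝ) × (Fin n → ℝ))) (j : Fin n) :
    (orthStep M basis j).steps ≤ (basis.length + 1) * (r * 12 + n * 6 + 3) := by
  have h := residual_steps_le M basis j
  have h' : (orthStep M basis j).steps ≤
      r * 3 + n * 2 + ((residual M basis j).steps + (r * 5 + (1 + (1 + (r * 4 + n * 4 + 1))))) := by
    by_cases h0 : (residual M basis j).val.1 ⬝ᵥ (residual M basis j).val.1 = 0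
    · unfold residual projectStep at h0 ⊢
      simp [orthStep, isZero, tabulate, load2, h0, dot_steps]
      omega
    · unfold residual projectStep at h0 ⊢
      simp [orthStep, isZero, tabulate, load2, h0, dot_steps, divBy_steps, rsqrt, pushList]
      omega
  nlinarith

theorem orthonormalize_steps_le (M : Matrix (Fin r) (Fin n) ℝ) :
    (orthonormalize M).steps ≤ n * (n * (r * 12 + n * 6 + 3) + 1) := by
  -- Each column adds at most one basis vector, so `basis.length + 1 ≤ n` whenever a column is still
  -- to be processed.
  have h := forEach_steps_le
    (fun (basis : List ((Fin r → ℝ) × (Fin n → ℝ))) (L : List (Fin n)) =>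
      basis.length + L.length ≤ n) (body := orthStep M) (c := n * (r * 12 + n * 6 + 3))
    (fun basis j L h => ?_) (fun basis j L h => ?_) (List.finRange n) [] (by simp)
  · rw [List.length_finRange] at h
    exact h
  · have := orthStep_length_le M basis j
    simp only [List.length_cons] at h
    omega
  · simp only [List.length_cons] at h
    exact (orthStep_steps_le M basis j).trans (Nat.mul_le_mul_right _ (by omega))

theorem weights_steps_le {t : ℕ} (basis : List ((Fin r → ℝ) × (Fin n → ℝ)))
    (U : Fin basis.length → Fin t → ℝ) :
    (weights basis U).steps ≤ t * (n * (basis.length * 6 + 2) + 2) := by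
  refine tabulate_steps_le fun i => tabulate_steps_le fun a => ?_
  refine sumLoop_steps_le fun c => ?_
  simp [loadList, load, load2, rmul]

theorem bjorckGolub_steps_le (A : Matrix (Fin r) (Fin n) ℝ) (B : Matrix (Fin r) (Fin l) ℝ)
    (hl : l ≤ n) : (bjorckGolub A B).steps ≤ 100 * (n ^ 2 * r + n ^ 3) := by
  have h1 := orthonormalize_steps_le A
  have h2 := orthonormalize_steps_le B
  have hQ : (orthonormalize A).val.length ≤ n := by
    rw [length_orthonormalize]; simpa using A.rank_le_width
  have hW : (orthonormalize B).val.length ≤ n := by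
    rw [length_orthonormalize]; exact B.rank_le_width.trans hl
  set p := (orthonormalize A).val.length
  set q := (orthonormalize B).val.length
  have hK : (tabulate fun a : Fin p => tabulate fun b : Fin q => do
      let v ← loadList (orthonormalize A).val a
      let w ← loadList (orthonormalize B).val b
      dot v.1 w.1).steps ≤ n * (n * (r * 5 + 4) + 2) := by
    refine (tabulate_steps_le fun a => tabulate_steps_le (c := r * 5 + 2) fun b => ?_).trans
      (by gcongr)
    simp only [steps_bind, dot_steps, loadList]
    omega
  have hS : (p + q) ^ 3 ≤ 8 * n ^ 3 := by
    calc (p + q) ^ 3 ≤ (n + n) ^ 3 := by gcongr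
      _ = 8 * n ^ 3 := by ring
  have hU : ∀ U, (weights (t := min p q) (orthonormalize A).val U).steps ≤
      n * (n * (n * 6 + 2) + 2) := fun U =>
    (weights_steps_le _ U).trans
      (Nat.mul_le_mul ((min_le_left _ _).trans hQ) (by gcongr))
  have hV : ∀ V, (weights (t := min p q) (orthonormalize B).val V).steps ≤
      n * (n * (n * 6 + 2) + 2) := fun V =>
    (weights_steps_le _ V).trans
      (Nat.mul_le_mul ((min_le_left _ _).trans hQ) (by gcongr))
  have h3 : l * (l * (r * 12 + l * 6 + 3) + 1) ≤ n * (n * (r * 12 + n * 6 + 3) + 1) := by gcongr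
  have h4 : n ≤ n ^ 3 := Nat.le_self_pow (by norm_num) n
  have h5 : n ^ 2 ≤ n ^ 3 := by
    rcases Nat.eq_zero_or_pos n with rfl | hn
    · simp
    · exact Nat.pow_le_pow_right hn (by norm_num)
  refine (add_le_add h1 (add_le_add (h2.trans h3) (add_le_add hK (add_le_add hS
    (add_le_add (hU _) (hV _)))))).trans ?_
  ring_nf
  nlinarith [Nat.zero_le (n ^ 2 * r)]

end Steps

/-! ### Correctness and cost of the sparse sketch -/

section Sketch

variable {m r n : ℕ}

theorem sketchSparse_steps_le (h : Fin m → Fin r) (d : Fin m → ℝ) (L : List (Fin m × Fin n × ℝ)) :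
    (sketchSparse h d L).steps ≤ r * (n * 2 + 2) + L.length * 7 := by
  refine add_le_add (tabulate_steps_le fun _ => ?_) ?_
  · exact tabulate_steps_le (c := 0) fun _ => le_rfl
  · exact forEach_steps_le (fun _ _ => True) (c := 6) (fun _ _ _ _ => trivial)
      (fun _ _ _ _ => by simp [load, load2, rmul, radd, store2]) _ _ trivial

open Classical in
theorem IsSparseRep.toFinset_eq {A : Matrix (Fin m) (Fin n) ℝ} {L : List (Fin m × Fin n × ℝ)}
    (hL : IsSparseRep A L) :
    L.toFinset = ({p | A p.1 p.2 ≠ 0} : Finset (Fin m × Fin n)).image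
      fun p => (p.1, p.2, A p.1 p.2) := by
  ext ⟨i, j, v⟩
  rw [List.mem_toFinset, hL.2]
  simp only [Finset.mem_image, Finset.mem_filter, Finset.mem_univ, true_and, Prod.mk.injEq,
    Prod.exists]
  constructor
  · rintro ⟨rfl, h⟩
    exact ⟨i, j, h, rfl, rfl, rfl⟩
  · rintro ⟨i, j, h, rfl, rfl, rfl⟩
    exact ⟨rfl, h⟩

theorem injective_entry (A : Matrix (Fin m) (Fin n) ℝ) :
    Function.Injective fun p : Fin m × Fin n => (p.1, p.2, A p.1 p.2) := fun p q h => by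
  simp only [Prod.mk.injEq] at h
  exact Prod.ext h.1 h.2.1

theorem IsSparseRep.length_eq {A : Matrix (Fin m) (Fin n) ℝ} {L : List (Fin m × Fin n × ℝ)}
    (hL : IsSparseRep A L) : L.length = nnz A := by
  classical
  rw [← List.toFinset_card_of_nodup hL.1, hL.toFinset_eq,
    Finset.card_image_of_injective _ (injective_entry A), nnz, ← Set.ncard_coe_finset]
  congr 1
  ext p
  simp

theorem sketch_apply (τ : Tape m r) (A : Matrix (Fin m) (Fin n) ℝ) (k : Fin r) (j : Fin n) :
    sketch τ A k j = ∑ i, if τ.1 i = k then sign (τ.2 i) * A i j else 0 := by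
  rw [sketch, Matrix.mul_apply]
  simp [hashMatrix, signMatrix, Matrix.diagonal_mul]

/-- The contribution of the entry `e` to the entry `(k, j)` of the sketch. -/
def contribution (h : Fin m → Fin r) (d : Fin m → ℝ) (k : Fin r) (j : Fin n)
    (e : Fin m × Fin n × ℝ) : ℝ :=
  if h e.1 = k ∧ e.2.1 = j then d e.1 * e.2.2 else 0

theorem sketchSparse_val_apply (h : Fin m → Fin r) (d : Fin m → ℝ) (L : List (Fin m × Fin n × ℝ))
    (k : Fin r) (j : Fin n) :
    (sketchSparse h d L).val k j = (L.map (contribution h d k j)).sum := by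
  -- The invariant: the current entry plus the contributions still to come is constant.
  have key := forEach_induct
    (fun (M : Fin r → Fin n → ℝ) (L' : List (Fin m × Fin n × ℝ)) =>
      M k j + (L'.map (contribution h d k j)).sum = (L.map (contribution h d k j)).sum)
    (body := fun M e => do
      let k ← load h e.1
      let s ← load d e.1
      let x ← rmul s e.2.2
      let y ← load2 M k e.2.1
      let z ← radd y x
      store2 M k e.2.1 z) ?_ L (fun _ _ => 0) (by simp)
  · rw [List.map_nil, List.sum_nil, add_zero] at key
    exact key
  · rintro M ⟨i, j', v⟩ L' hM
    rw [← hM]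
    simp only [val_bind, load, rmul, load2, radd, store2, List.map_cons, List.sum_cons,
      contribution]
    by_cases h1 : h i = k
    · by_cases h2 : j' = j
      · subst h1 h2
        simp [add_assoc]
      · subst h1
        simp [h2, Function.update_of_ne (Ne.symm h2)]
    · simp [h1, Function.update_of_ne (Ne.symm h1)]

theorem sketchSparse_val {A : Matrix (Fin m) (Fin n) ℝ} {L : List (Fin m × Fin n × ℝ)}
    (hL : IsSparseRep A L) (τ : Tape m r) :
    (sketchSparse τ.1 (fun i => sign (τ.2 i)) L).val = sketch τ A := by
  classical
  ext k j
  rw [sketchSparse_val_apply, sketch_apply, ← List.sum_toFinset _ hL.1, hL.toFinset_eq,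
    Finset.sum_image (injective_entry A).injOn, Finset.sum_filter_of_ne,
    Fintype.sum_prod_type]
  · refine Finset.sum_congr rfl fun i _ => ?_
    rw [Finset.sum_eq_single j (fun j' _ hj => by simp [contribution, hj]) (by simp)]
    simp [contribution]
  · intro p _ hp h0
    exact hp (by simp [contribution, h0])

end Sketch

/-! ### Canonical systems and the min-max principle -/

section Variational

variable {m n l k : ℕ} {A : Matrix (Fin m) (Fin n) ℝ} {B : Matrix (Fin m) (Fin l) ℝ}
  {x : Fin k → Fin n → ℝ} {y : Fin k → Fin l → ℝ}

theorem IsCanonicalSystem.symm (h : IsCanonicalSystem A B x y) : IsCanonicalSystem B A y x :=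
  fun i => ⟨(h i).2.1, (h i).1, fun y' hy' x' hx' => by
    rw [cosine_comm, cosine_comm (B *ᵥ y i)]
    exact (h i).2.2 x' hx' y' hy'⟩

theorem IsCanonicalSystem.orth (h : IsCanonicalSystem A B x y) {i j : Fin k} (hij : i ≠ j) :
    (A *ᵥ x i) ⬝ᵥ (A *ᵥ x j) = 0 := by
  rcases lt_or_gt_of_ne hij with h1 | h1
  · rw [dotProduct_comm]
    exact (h j).1.2 i h1
  · exact (h i).1.2 j h1

theorem IsCanonicalSystem.cosine_anti (h : IsCanonicalSystem A B x y) {i j : Fin k} (hij : i ≤ j) :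
    cosine (A *ᵥ x j) (B *ᵥ y j) ≤ cosine (A *ᵥ x i) (B *ᵥ y i) :=
  (h i).2.2 _ ⟨(h j).1.1, fun p hp => (h j).1.2 p (hp.trans_le hij)⟩ _
    ⟨(h j).2.1.1, fun p hp => (h j).2.1.2 p (hp.trans_le hij)⟩

/-- Squaring and clearing denominators makes maximality polynomial, so that it can be tested along a
line. -/
theorem sq_dot_le_of_cosine_le {u u' v : Fin m → ℝ} (hu : u ≠ 0) (hu' : u' ≠ 0) (hv : v ≠ 0)
    (h : cosine u' v ≤ cosine u v) :
    (u' ⬝ᵥ v) ^ 2 * (u ⬝ᵥ u) ≤ (u ⬝ᵥ v) ^ 2 * (u' ⬝ᵥ u') := by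
  have h1 := cosine_mul hu hv
  have h2 := cosine_mul hu' hv
  rw [← sq_abs (u' ⬝ᵥ v), ← sq_abs (u ⬝ᵥ v), ← h1, ← h2, ← l2norm_sq, ← l2norm_sq]
  have h3 : cosine u' v ^ 2 ≤ cosine u v ^ 2 := pow_le_pow_left₀ (cosine_nonneg _ _) h 2
  have h4 := mul_le_mul_of_nonneg_right h3 (sq_nonneg (l2norm u * l2norm u' * l2norm v))
  linarith

theorem eq_zero_of_forall_quadratic_nonpos {p q : ℝ} (h : ∀ t : ℝ, 2 * t * p + t ^ 2 * q ≤ 0) :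
    p = 0 := by
  by_contra hp
  have hc : 0 < |q| + 1 := by positivity
  have h1 := h (p / (|q| + 1))
  have h2 : 2 * (p / (|q| + 1)) * p + (p / (|q| + 1)) ^ 2 * q =
      p ^ 2 * (2 * (|q| + 1) + q) / (|q| + 1) ^ 2 := by
    field_simp
  rw [h2] at h1
  have h3 : 0 < 2 * (|q| + 1) + q := by linarith [neg_abs_le q]
  have : 0 < p ^ 2 * (2 * (|q| + 1) + q) / (|q| + 1) ^ 2 := by positivity
  linarith

/-- The first-order optimality condition for the `i`-th pair. -/
theorem IsCanonicalSystem.dot_eq_zero (h : IsCanonicalSystem A B x y) (i : Fin k)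
    {x' : Fin n → ℝ} (hx' : ∀ j ≤ i, (A *ᵥ x') ⬝ᵥ (A *ᵥ x j) = 0) :
    (A *ᵥ x') ⬝ᵥ (B *ᵥ y i) = 0 := by
  obtain ⟨⟨hi, hi'⟩, ⟨hy, hy'⟩, hmax⟩ := h i
  set u := A *ᵥ x i
  set v := B *ᵥ y i
  set w := A *ᵥ x'
  have hpos : 0 < u ⬝ᵥ u := dot_self_pos hi
  have hwu : w ⬝ᵥ u = 0 := hx' i le_rfl
  have huw : u ⬝ᵥ w = 0 := by rw [dotProduct_comm, hwu]
  -- Maximality against the competitor `x i + t • x'`, which stays admissible. A quadratic without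
  -- constant term that is never positive has zero linear coefficient.
  have key : ∀ t : ℝ, 2 * t * ((u ⬝ᵥ v) * (w ⬝ᵥ v) * (u ⬝ᵥ u)) +
      t ^ 2 * ((w ⬝ᵥ v) ^ 2 * (u ⬝ᵥ u) - (u ⬝ᵥ v) ^ 2 * (w ⬝ᵥ w)) ≤ 0 := by
    intro t
    have e : A *ᵥ (x i + t • x') = u + t • w := by rw [Matrix.mulVec_add, Matrix.mulVec_smul]
    have hne : u + t • w ≠ 0 := by
      intro h0
      have := congrArg (fun z => z ⬝ᵥ u) h0
      simp only [add_dotProduct, smul_dotProduct, hwu, smul_zero, add_zero,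
        zero_dotProduct] at this
      exact hpos.ne' this
    have h1 := hmax (x i + t • x') ⟨by rwa [e], fun j hj => by
      rw [e, add_dotProduct, smul_dotProduct, hx' j hj.le, hi' j hj]; simp⟩ (y i) ⟨hy, hy'⟩
    rw [e] at h1
    have h2 := sq_dot_le_of_cosine_le hi hne hy h1
    simp only [add_dotProduct, dotProduct_add, smul_dotProduct, dotProduct_smul, smul_eq_mul, hwu,
      huw] at h2
    linarith
  have h0 := eq_zero_of_forall_quadratic_nonpos key
  by_contra hne
  have h3 : u ⬝ᵥ v = 0 := by
    rcases mul_eq_zero.mp h0 with h0 | h0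
    · exact (mul_eq_zero.mp h0).resolve_right hne
    · exact absurd h0 hpos.ne'
  -- When the maximal correlation is zero the linear coefficient carries no information, but the
  -- quadratic one would be positive.
  have h4 := key 1
  rw [h3] at h4
  have : 0 < (w ⬝ᵥ v) ^ 2 * (u ⬝ᵥ u) := by positivity
  linarith

/-- The optimality condition is applied at the smaller index: there the later vector is orthogonal
to all vectors up to and including that index. -/
theorem IsCanonicalSystem.cross (h : IsCanonicalSystem A B x y) {i j : Fin k} (hij : i ≠ j) :
    (A *ᵥ x i) ⬝ᵥ (B *ᵥ y j) = 0 := by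
  rcases lt_or_gt_of_ne hij with h1 | h1
  · rw [dotProduct_comm]
    exact h.symm.dot_eq_zero i fun p hp => h.symm.orth (hp.trans_lt h1).ne'
  · exact h.dot_eq_zero j fun p hp => h.orth (hp.trans_lt h1).ne'

/-- If `A x'` is orthogonal to the first `i` vectors `A x_j`, then its correlation with every vector
of the column space of `B` is at most the `i`-th canonical correlation. -/
theorem IsCanonicalSystem.abs_dot_le (h : IsCanonicalSystem A B x y) (i : Fin k) {x' : Fin n → ℝ}
    (hx' : ∀ j < i, (A *ᵥ x') ⬝ᵥ (A *ᵥ x j) = 0) (y' : Fin l → ℝ) :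
    |(A *ᵥ x') ⬝ᵥ (B *ᵥ y')| ≤
      cosine (A *ᵥ x i) (B *ᵥ y i) * (l2norm (A *ᵥ x') * l2norm (B *ᵥ y')) := by
  -- To make `y'` admissible, its components along `B y_j` with `j < i` are removed one at a time.
  -- By first-order optimality `A x'` is orthogonal to these, so the inner product is unchanged
  -- while the norm does not grow.
  have proj : ∀ p : ℕ, p ≤ i.val → ∃ z : Fin l → ℝ,
      (∀ j : Fin k, j.val < p → (B *ᵥ z) ⬝ᵥ (B *ᵥ y j) = 0) ∧
      (A *ᵥ x') ⬝ᵥ (B *ᵥ z) = (A *ᵥ x') ⬝ᵥ (B *ᵥ y') ∧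
      (B *ᵥ z) ⬝ᵥ (B *ᵥ z) ≤ (B *ᵥ y') ⬝ᵥ (B *ᵥ y') := by
    intro p
    induction p with
    | zero => exact fun _ => ⟨y', by simp, rfl, le_rfl⟩
    | succ p ih =>
      intro hp
      obtain ⟨z, h1, h2, h3⟩ := ih (by omega)
      let q : Fin k := ⟨p, by omega⟩
      have hq : 0 < (B *ᵥ y q) ⬝ᵥ (B *ᵥ y q) := dot_self_pos (h q).2.1.1
      set c := ((B *ᵥ z) ⬝ᵥ (B *ᵥ y q)) / ((B *ᵥ y q) ⬝ᵥ (B *ᵥ y q))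
      have hc : c * ((B *ᵥ y q) ⬝ᵥ (B *ᵥ y q)) = (B *ᵥ z) ⬝ᵥ (B *ᵥ y q) :=
        div_mul_cancel₀ _ hq.ne'
      have e : B *ᵥ (z - c • y q) = B *ᵥ z - c • B *ᵥ y q := by
        rw [Matrix.mulVec_sub, Matrix.mulVec_smul]
      refine ⟨z - c • y q, fun j hj => ?_, ?_, ?_⟩
      · rw [e, sub_dotProduct, smul_dotProduct, smul_eq_mul]
        by_cases hjq : j = q
        · rw [hjq, hc, sub_self]
        · have : j.val ≠ p := fun h0 => hjq (Fin.ext h0)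
          rw [h1 j (by omega), h.symm.orth (Ne.symm hjq)]
          simp
      · have h0 : (A *ᵥ x') ⬝ᵥ (B *ᵥ y q) = 0 :=
          h.dot_eq_zero q fun j hj => hx' j (hj.trans_lt (Fin.lt_def.mpr (by simpa [q] using hp)))
        rw [e, dotProduct_sub, dotProduct_smul, h0, smul_zero, sub_zero, h2]
      · rw [e]
        simp only [sub_dotProduct, dotProduct_sub, smul_dotProduct, dotProduct_smul, smul_eq_mul]
        rw [dotProduct_comm (B *ᵥ y q) (B *ᵥ z), ← hc]
        nlinarith [mul_nonneg (sq_nonneg c) hq.le]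
  obtain ⟨z, h1, h2, h3⟩ := proj i.val le_rfl
  rw [← h2]
  by_cases hz : B *ᵥ z = 0
  · rw [hz, dotProduct_zero, abs_zero]
    exact mul_nonneg (cosine_nonneg _ _) (mul_nonneg (l2norm_nonneg _) (l2norm_nonneg _))
  by_cases hw : A *ᵥ x' = 0
  · rw [hw, zero_dotProduct, abs_zero]
    exact mul_nonneg (cosine_nonneg _ _) (mul_nonneg (l2norm_nonneg _) (l2norm_nonneg _))
  rw [← cosine_mul hw hz]
  refine mul_le_mul ((h i).2.2 x' ⟨hw, hx'⟩ z ⟨hz, fun j hj => h1 j hj⟩) ?_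
    (mul_nonneg (l2norm_nonneg _) (l2norm_nonneg _)) (cosine_nonneg _ _)
  exact mul_le_mul_of_nonneg_left ((l2norm_le_iff _ _).mpr h3) (l2norm_nonneg _)

/-- Every combination of the first `i + 1` vectors `A x_j` has correlation at least the `i`-th
canonical correlation with some vector of the column space of `B`. -/
theorem IsCanonicalSystem.exists_le_dot (h : IsCanonicalSystem A B x y) (i : Fin k) (c : Fin k → ℝ)
    (hc : ∀ j, i < j → c j = 0) (hc0 : c ≠ 0) :
    A *ᵥ (∑ j, c j • x j) ≠ 0 ∧ ∃ w, B *ᵥ w ≠ 0 ∧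
      cosine (A *ᵥ x i) (B *ᵥ y i) * (l2norm (A *ᵥ (∑ j, c j • x j)) * l2norm (B *ᵥ w)) ≤
        (A *ᵥ (∑ j, c j • x j)) ⬝ᵥ (B *ᵥ w) := by
  set a : Fin k → ℝ := fun j => l2norm (A *ᵥ x j)
  set b : Fin k → ℝ := fun j => l2norm (B *ᵥ y j)
  have ha : ∀ j, 0 < a j := fun j => l2norm_pos (h j).1.1
  have hb : ∀ j, 0 < b j := fun j => l2norm_pos (h j).2.1.1
  set α : Fin k → ℝ := fun j => (A *ᵥ x j) ⬝ᵥ (B *ᵥ y j)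
  have hα : ∀ j, |α j| = cosine (A *ᵥ x j) (B *ᵥ y j) * (a j * b j) := fun j =>
    (cosine_mul (h j).1.1 (h j).2.1.1).symm
  have hs : ∀ j, ∃ s : ℝ, s * s = 1 ∧ s * α j = |α j| := fun j => by
    rcases le_total 0 (α j) with h0 | h0
    · exact ⟨1, by norm_num, by rw [one_mul, abs_of_nonneg h0]⟩
    · exact ⟨-1, by norm_num, by rw [abs_of_nonpos h0]; ring⟩
  choose s hs1 hs2 using hs
  -- In the normalized bases the partner has the same coefficients up to sign. The ratio equalizes
  -- the two norms and the signs make every diagonal term nonnegative.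
  set d : Fin k → ℝ := fun j => c j * s j * (a j / b j)
  have eA : A *ᵥ (∑ j, c j • x j) = ∑ j, c j • A *ᵥ x j := by
    simp only [Matrix.mulVec_sum, Matrix.mulVec_smul]
  have eB : B *ᵥ (∑ j, d j • y j) = ∑ j, d j • B *ᵥ y j := by
    simp only [Matrix.mulVec_sum, Matrix.mulVec_smul]
  have nA : (A *ᵥ (∑ j, c j • x j)) ⬝ᵥ (A *ᵥ (∑ j, c j • x j)) = ∑ j, c j ^ 2 * a j ^ 2 := by
    rw [eA, dot_sum_sum fun i j hij => h.orth hij]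
    refine Finset.sum_congr rfl fun j _ => ?_
    rw [l2norm_sq, sq]
  have nB : (B *ᵥ (∑ j, d j • y j)) ⬝ᵥ (B *ᵥ (∑ j, d j • y j)) = ∑ j, c j ^ 2 * a j ^ 2 := by
    rw [eB, dot_sum_sum fun i j hij => h.symm.orth hij]
    refine Finset.sum_congr rfl fun j _ => ?_
    have h1 : d j * b j = c j * s j * a j := by
      rw [mul_assoc, div_mul_cancel₀ _ (hb j).ne']
    rw [← l2norm_sq]
    calc d j * d j * b j ^ 2 = (d j * b j) ^ 2 := by ring
      _ = c j ^ 2 * (s j * s j) * a j ^ 2 := by rw [h1]; ring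
      _ = _ := by rw [hs1, mul_one]
  have hpos : 0 < ∑ j, c j ^ 2 * a j ^ 2 := by
    obtain ⟨j, hj⟩ := Function.ne_iff.mp hc0
    refine Finset.sum_pos' (fun j _ => by positivity) ⟨j, Finset.mem_univ _, ?_⟩
    have : c j ≠ 0 := hj
    have := ha j
    positivity
  have hne : l2norm (B *ᵥ (∑ j, d j • y j)) = l2norm (A *ᵥ (∑ j, c j • x j)) :=
    le_antisymm ((l2norm_le_iff _ _).mpr (by rw [nA, nB])) ((l2norm_le_iff _ _).mpr (by rw [nA, nB]))
  refine ⟨fun h0 => ?_, ∑ j, d j • y j, fun h0 => ?_, ?_⟩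
  · rw [h0, zero_dotProduct] at nA
    exact hpos.ne nA
  · rw [h0, zero_dotProduct] at nB
    exact hpos.ne nB
  · rw [hne, ← sq, l2norm_sq, nA, eA, eB, dot_sum_sum fun i j hij => h.cross hij, Finset.mul_sum]
    refine Finset.sum_le_sum fun j _ => ?_
    rcases lt_or_ge i j with hij | hij
    · simp [d, hc j hij]
    · have h1 : c j * d j * α j =
          cosine (A *ᵥ x j) (B *ᵥ y j) * (c j ^ 2 * a j ^ 2) := by
        calc c j * d j * α j = c j ^ 2 * (a j / b j) * (s j * α j) := by ring
          _ = cosine (A *ᵥ x j) (B *ᵥ y j) * (c j ^ 2 * a j * (a j / b j * b j)) := by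
            rw [hs2, hα]; ring
          _ = _ := by rw [div_mul_cancel₀ _ (hb j).ne']; ring
      rw [h1]
      exact mul_le_mul_of_nonneg_right (h.cosine_anti hij) (by positivity)

/-- The comparison of two canonical systems by the min-max principle. -/
theorem IsCanonicalSystem.exists_compare {m' : ℕ} {A' : Matrix (Fin m') (Fin n) ℝ}
    {B' : Matrix (Fin m') (Fin l) ℝ} {x' : Fin k → Fin n → ℝ} {y' : Fin k → Fin l → ℝ}
    (h : IsCanonicalSystem A B x y) (h' : IsCanonicalSystem A' B' x' y') (i : Fin k) :
    ∃ z w, A *ᵥ z ≠ 0 ∧ B *ᵥ w ≠ 0 ∧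
      cosine (A *ᵥ x i) (B *ᵥ y i) * (l2norm (A *ᵥ z) * l2norm (B *ᵥ w)) ≤
        |(A *ᵥ z) ⬝ᵥ (B *ᵥ w)| ∧
      |(A' *ᵥ z) ⬝ᵥ (B' *ᵥ w)| ≤
        cosine (A' *ᵥ x' i) (B' *ᵥ y' i) * (l2norm (A' *ᵥ z) * l2norm (B' *ᵥ w)) := by
  have hk : ∃ c : Fin k → ℝ, c ≠ 0 ∧ (∀ j, i < j → c j = 0) ∧
      ∀ p < i, (A' *ᵥ (∑ j, c j • x j)) ⬝ᵥ (A' *ᵥ x' p) = 0 := by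
    -- With indices starting at 0, there are `i + 1` coefficients and only `i` orthogonality
    -- conditions, so a nonzero solution exists. It is extended by zero beyond `i`.
    let F : (Set.Iic i → ℝ) →ₗ[ℝ] (Set.Iio i → ℝ) :=
      { toFun := fun c p => ∑ j, c j * ((A' *ᵥ x j) ⬝ᵥ (A' *ᵥ x' p))
        map_add' := fun c d => by ext p; simp [add_mul, Finset.sum_add_distrib]
        map_smul' := fun c d => by ext p; simp [Finset.mul_sum, mul_assoc] }
    have hF : LinearMap.ker F ≠ ⊥ := by
      apply LinearMap.ker_ne_bot_of_finrank_lt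
      simp
    obtain ⟨c, hc, hc0⟩ := Submodule.exists_mem_ne_zero_of_ne_bot hF
    refine ⟨fun j => if hj : j ≤ i then c ⟨j, hj⟩ else 0, ?_, fun j hj => by simp [hj], ?_⟩
    · intro h0
      apply hc0
      ext ⟨j, hj⟩
      have := congrFun h0 j
      simpa [Set.mem_Iic.mp hj] using this
    · intro p hp
      have h0 : ∑ j : Set.Iic i, c j * ((A' *ᵥ x j) ⬝ᵥ (A' *ᵥ x' p)) = 0 :=
        congrFun (LinearMap.mem_ker.mp hc) ⟨p, hp⟩
      refine Eq.trans ?_ h0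
      simp only [Matrix.mulVec_sum, Matrix.mulVec_smul, sum_dotProduct, smul_dotProduct,
        smul_eq_mul]
      rw [← Finset.sum_subset (Finset.subset_univ (Finset.univ.filter (· ≤ i)))
        (fun j _ hj => by simp at hj; simp [hj]),
        Finset.sum_subtype (p := (· ∈ Set.Iic i)) _ (by simp)]
      refine Finset.sum_congr rfl fun j _ => ?_
      rw [dif_pos (Set.mem_Iic.mp j.2)]
  obtain ⟨c, hc0, hc, hp⟩ := hk
  obtain ⟨h1, w, h2, h3⟩ := h.exists_le_dot i c hc hc0
  exact ⟨_, w, h1, h2, h3.trans (le_abs_self _), h'.abs_dot_le i hp w⟩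

end Variational

/-! ### Stability of CCA under near isometries -/

section Embedding

/-- The inner products of the vectors `A' z`, `B' w` agree with those of `A z`, `B w` up to a
relative error `e`. -/
def NearlyIsometric {m m' n l : ℕ} (A : Matrix (Fin m) (Fin n) ℝ) (B : Matrix (Fin m) (Fin l) ℝ)
    (A' : Matrix (Fin m') (Fin n) ℝ) (B' : Matrix (Fin m') (Fin l) ℝ) (e : ℝ) : Prop :=
  ∀ z w, |(A' *ᵥ z) ⬝ᵥ (B' *ᵥ w) - (A *ᵥ z) ⬝ᵥ (B *ᵥ w)| ≤ e * (l2norm (A *ᵥ z) * l2norm (B *ᵥ w))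

variable {m m' n l : ℕ} {A : Matrix (Fin m) (Fin n) ℝ} {B : Matrix (Fin m) (Fin l) ℝ}
  {A' : Matrix (Fin m') (Fin n) ℝ} {B' : Matrix (Fin m') (Fin l) ℝ} {e : ℝ}

theorem NearlyIsometric.abs_sq_sub_sq_le (h : NearlyIsometric A A A' A' e) (z : Fin n → ℝ) :
    |l2norm (A' *ᵥ z) ^ 2 - l2norm (A *ᵥ z) ^ 2| ≤ e * l2norm (A *ᵥ z) ^ 2 := by
  have := h z z
  rwa [← l2norm_sq, ← l2norm_sq, ← sq] at this

theorem NearlyIsometric.mulVec_eq_zero_iff (h : NearlyIsometric A A A' A' e) (he : e < 1)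
    (z : Fin n → ℝ) : A' *ᵥ z = 0 ↔ A *ᵥ z = 0 := by
  have h1 := abs_le.mp (h.abs_sq_sub_sq_le z)
  rw [← l2norm_eq_zero, ← l2norm_eq_zero (u := A *ᵥ z)]
  constructor
  · intro h0
    rw [h0] at h1
    have : (1 - e) * l2norm (A *ᵥ z) ^ 2 ≤ 0 := by linarith
    have h2 : l2norm (A *ᵥ z) ^ 2 ≤ 0 := nonpos_of_mul_nonpos_right this (by linarith)
    exact pow_eq_zero_iff two_ne_zero |>.mp (le_antisymm h2 (sq_nonneg _))
  · intro h0
    rw [h0] at h1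
    exact pow_eq_zero_iff two_ne_zero |>.mp (le_antisymm (by linarith) (sq_nonneg _))

/-- A relative error below 1 preserves the kernel, and rank–nullity does the rest. -/
theorem NearlyIsometric.rank_eq (h : NearlyIsometric A A A' A' e) (he : e < 1) :
    A'.rank = A.rank := by
  have hker : LinearMap.ker A'.mulVecLin = LinearMap.ker A.mulVecLin := by
    ext z
    simpa using h.mulVec_eq_zero_iff he z
  have h1 := A.mulVecLin.finrank_range_add_finrank_ker
  have h2 := A'.mulVecLin.finrank_range_add_finrank_ker
  rw [hker] at h2
  rw [Matrix.rank, Matrix.rank]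
  omega

/-- Each squared norm changes by a factor in [1 - e, 1 + e]; a product of two norms therefore does
too, after a square root. -/
theorem l2norm_mul_bounds (hA : NearlyIsometric A A A' A' e) (hB : NearlyIsometric B B B' B' e)
    (he0 : 0 ≤ e) (he : e < 1) (z : Fin n → ℝ) (w : Fin l → ℝ) :
    (1 - e) * (l2norm (A *ᵥ z) * l2norm (B *ᵥ w)) ≤ l2norm (A' *ᵥ z) * l2norm (B' *ᵥ w) ∧
      l2norm (A' *ᵥ z) * l2norm (B' *ᵥ w) ≤ (1 + e) * (l2norm (A *ᵥ z) * l2norm (B *ᵥ w)) := by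
  have h1 := abs_le.mp (hA.abs_sq_sub_sq_le z)
  have h2 := abs_le.mp (hB.abs_sq_sub_sq_le w)
  have p1 := l2norm_nonneg (A *ᵥ z)
  have p2 := l2norm_nonneg (B *ᵥ w)
  have p3 := l2norm_nonneg (A' *ᵥ z)
  have p4 := l2norm_nonneg (B' *ᵥ w)
  constructor
  · rw [← sq_le_sq₀ (mul_nonneg (by linarith) (mul_nonneg p1 p2)) (mul_nonneg p3 p4)]
    calc ((1 - e) * (l2norm (A *ᵥ z) * l2norm (B *ᵥ w))) ^ 2 =
        ((1 - e) * l2norm (A *ᵥ z) ^ 2) * ((1 - e) * l2norm (B *ᵥ w) ^ 2) := by ring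
      _ ≤ l2norm (A' *ᵥ z) ^ 2 * l2norm (B' *ᵥ w) ^ 2 :=
        mul_le_mul (by linarith) (by linarith) (mul_nonneg (by linarith) (sq_nonneg _))
          (sq_nonneg _)
      _ = _ := by ring
  · rw [← sq_le_sq₀ (mul_nonneg p3 p4) (mul_nonneg (by linarith) (mul_nonneg p1 p2))]
    calc (l2norm (A' *ᵥ z) * l2norm (B' *ᵥ w)) ^ 2 =
        l2norm (A' *ᵥ z) ^ 2 * l2norm (B' *ᵥ w) ^ 2 := by ring
      _ ≤ ((1 + e) * l2norm (A *ᵥ z) ^ 2) * ((1 + e) * l2norm (B *ᵥ w) ^ 2) :=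
        mul_le_mul (by linarith) (by linarith) (sq_nonneg _) (by positivity)
      _ = _ := by ring

/-- Canonical correlations are stable under nearly isometric maps. -/
theorem abs_cosine_sub_cosine_le {k : ℕ} {x x' : Fin k → Fin n → ℝ} {y y' : Fin k → Fin l → ℝ}
    (hA : NearlyIsometric A A A' A' e) (hB : NearlyIsometric B B B' B' e)
    (hAB : NearlyIsometric A B A' B' e) (he0 : 0 ≤ e) (he : e < 1)
    (h : IsCanonicalSystem A B x y) (h' : IsCanonicalSystem A' B' x' y') (i : Fin k) :
    |cosine (A *ᵥ x i) (B *ᵥ y i) - cosine (A' *ᵥ x' i) (B' *ᵥ y' i)| ≤ 2 * e := by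
  set s := cosine (A *ᵥ x i) (B *ᵥ y i)
  set s' := cosine (A' *ᵥ x' i) (B' *ᵥ y' i)
  have hs0 : 0 ≤ s' := cosine_nonneg _ _
  have hs1 : s' ≤ 1 := cosine_le_one _ _
  have hs2 : 0 ≤ s := cosine_nonneg _ _
  rw [abs_le]
  constructor
  -- Both directions use `s' ≤ 1` to turn the relative error e of the norms into an additive one;
  -- the inner product adds another e.
  · obtain ⟨z, w, hz, hw, h1, h2⟩ := h'.exists_compare h i
    rw [Ne, hA.mulVec_eq_zero_iff he] at hz
    rw [Ne, hB.mulVec_eq_zero_iff he] at hw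
    have hP := mul_pos (l2norm_pos hz) (l2norm_pos hw)
    have h3 := (l2norm_mul_bounds hA hB he0 he z w).1
    have h4 := abs_sub_abs_le_abs_sub ((A' *ᵥ z) ⬝ᵥ (B' *ᵥ w)) ((A *ᵥ z) ⬝ᵥ (B *ᵥ w))
    have h5 := hAB z w
    have h6 := mul_le_mul_of_nonneg_left h3 hs0
    have h7 : s' * (1 - e) ≤ s + e := by
      refine le_of_mul_le_mul_right ?_ hP
      linarith
    nlinarith
  · obtain ⟨z, w, hz, hw, h1, h2⟩ := h.exists_compare h' i
    have hP := mul_pos (l2norm_pos hz) (l2norm_pos hw)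
    have h3 := (l2norm_mul_bounds hA hB he0 he z w).2
    have h4 := abs_sub_abs_le_abs_sub ((A *ᵥ z) ⬝ᵥ (B *ᵥ w)) ((A' *ᵥ z) ⬝ᵥ (B' *ᵥ w))
    have h5 := hAB z w
    rw [abs_sub_comm] at h5
    have h6 := mul_le_mul_of_nonneg_left h3 hs0
    have h7 : s ≤ s' * (1 + e) + e := by
      refine le_of_mul_le_mul_right ?_ hP
      linarith
    nlinarith

/-- An exact canonical correlation analysis of a nearly isometric image is an approximate one of
the original pair. -/
theorem IsExactCCA.isApproxCCA {out : Output n l} (hout : IsExactCCA A' B' out) {η : ℝ}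
    (hA : NearlyIsometric A A A' A' e) (hB : NearlyIsometric B B B' B' e)
    (hAB : NearlyIsometric A B A' B' e) (he0 : 0 ≤ e) (he : 4 * e ≤ η) (hη : η ≤ 1) :
    IsApproxCCA A B η out := by
  have he1 : e < 1 := by linarith
  have hnum : out.num = min A.rank B.rank := by
    rw [hout.num_eq, hA.rank_eq he1, hB.rank_eq he1]
  have close : ∀ σ : Fin out.num → ℝ, IsCanonicalCorrelations A B σ → ∀ i,
      |σ i - out.corr i| ≤ 2 * e := by
    rintro σ ⟨x, y, hxy, hσ⟩ i
    rw [hσ, hout.corr_eq]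
    exact abs_cosine_sub_cosine_le hA hB hAB he0 he1 hxy hout.system i
  have hnorm : ∀ {q : ℕ} {C : Matrix (Fin m) (Fin q) ℝ} {C' : Matrix (Fin m') (Fin q) ℝ},
      NearlyIsometric C C C' C' e → ∀ z, l2norm (C' *ᵥ z) = 1 →
        |l2norm (C *ᵥ z) ^ 2 - 1| ≤ η ∧ l2norm (C *ᵥ z) ^ 2 ≤ 2 := by
    intro q C C' hC z hz
    have h1 := hC.abs_sq_sub_sq_le z
    rw [hz, abs_sub_comm, one_pow] at h1
    have h2 := abs_le.mp h1
    -- Here e ≤ 1/4, so the squared norm is at most 1/(1 - e) ≤ 2, and the error is at most 2e.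
    have h3 : l2norm (C *ᵥ z) ^ 2 ≤ 2 := by nlinarith [sq_nonneg (l2norm (C *ᵥ z))]
    exact ⟨h1.trans (by nlinarith), h3⟩
  have horth : ∀ {q : ℕ} {C : Matrix (Fin m) (Fin q) ℝ} {C' : Matrix (Fin m') (Fin q) ℝ},
      NearlyIsometric C C C' C' e → ∀ z w, l2norm (C' *ᵥ z) = 1 → l2norm (C' *ᵥ w) = 1 →
        (C' *ᵥ z) ⬝ᵥ (C' *ᵥ w) = 0 → |(C *ᵥ z) ⬝ᵥ (C *ᵥ w)| ≤ η := by
    intro q C C' hC z w hz hw hzw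
    have h1 := hC z w
    rw [hzw, zero_sub, abs_neg] at h1
    have h2 : l2norm (C *ᵥ z) * l2norm (C *ᵥ w) ≤ 2 := by
      nlinarith [(hnorm hC z hz).2, (hnorm hC w hw).2,
        sq_nonneg (l2norm (C *ᵥ z) - l2norm (C *ᵥ w))]
    nlinarith
  refine ⟨by linarith, hη, hnum, fun i => by rw [hout.corr_eq]; exact cosine_nonneg _ _, ?_,
    fun σ hσ i => (close σ hσ i).trans (by linarith), fun i => (hnorm hA _ (hout.normA i)).1,
    fun i j hij => horth hA _ _ (hout.normA i) (hout.normA j) (hout.system.orth hij),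
    fun i => (hnorm hB _ (hout.normB i)).1,
    fun i j hij => horth hB _ _ (hout.normB i) (hout.normB j) (hout.system.symm.orth hij), ?_⟩
  -- Existence for the original pair comes from running the exact algorithm on it. Generalizing the
  -- output allows its length to be identified with `out.num`.
  · have hex := bjorckGolub_isExactCCA A B
    generalize (bjorckGolub A B).val = o at hex
    obtain ⟨q, c, wA, wB⟩ := o
    have hq : out.num = q := hnum.trans hex.num_eq.symm
    rw [hq]
    exact ⟨c, wA, wB, hex.system, hex.corr_eq⟩
  · intro σ hσ i
    have h1 := close σ hσ i
    have h2 := hout.corr_eq i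
    have hz : A *ᵥ out.wA i ≠ 0 := fun h0 =>
      (hout.system i).1.1 ((hA.mulVec_eq_zero_iff he1 _).mpr h0)
    have hw : B *ᵥ out.wB i ≠ 0 := fun h0 =>
      (hout.system i).2.1.1 ((hB.mulVec_eq_zero_iff he1 _).mpr h0)
    have hP := mul_pos (l2norm_pos hz) (l2norm_pos hw)
    obtain ⟨h3, h4⟩ := l2norm_mul_bounds hA hB he0 he1 (out.wA i) (out.wB i)
    rw [hout.normA, hout.normB, mul_one] at h3 h4
    have h5 : |cosine (A *ᵥ out.wA i) (B *ᵥ out.wB i) *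
        (l2norm (A *ᵥ out.wA i) * l2norm (B *ᵥ out.wB i)) - out.corr i| ≤
        e * (l2norm (A *ᵥ out.wA i) * l2norm (B *ᵥ out.wB i)) := by
      rw [cosine_mul hz hw, h2, cosine, hout.normA, hout.normB, mul_one, div_one]
      refine (abs_abs_sub_abs_le _ _).trans ?_
      rw [abs_sub_comm]
      exact hAB _ _
    have h6 : 0 ≤ out.corr i := by rw [h2]; exact cosine_nonneg _ _
    have h7 : out.corr i ≤ 1 := by rw [h2]; exact cosine_le_one _ _
    generalize cosine (A *ᵥ out.wA i) (B *ᵥ out.wB i) = t at h5 ⊢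
    generalize l2norm (A *ᵥ out.wA i) * l2norm (B *ᵥ out.wB i) = P at hP h3 h4 h5
    -- From `|t P - corr| ≤ e P`, `|P - 1| ≤ e P` and `corr ≤ 1`. With the 2e from `close` this
    -- totals 4e ≤ η.
    have h8 : |out.corr i - t| ≤ 2 * e := by
      obtain ⟨h9, h10⟩ := abs_le.mp h5
      rw [abs_le]
      constructor
      · refine le_of_mul_le_mul_right ?_ hP
        nlinarith
      · refine le_of_mul_le_mul_right ?_ hP
        nlinarith
    calc |σ i - t| ≤ |σ i - out.corr i| + |out.corr i - t| := abs_sub_le _ _ _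
      _ ≤ η := by linarith

end Embedding

/-! ### Second moment of the sketching error -/

section SecondMoment

variable {m r : ℕ}

theorem sign_mul_self (b : Bool) : sign b * sign b = 1 := by cases b <;> simp [sign]

theorem sign_not (b : Bool) : sign (!b) = -sign b := by cases b <;> simp [sign]

/-- The error of the embedding on the inner product of `x` and `y`. -/
def sketchError (τ : Tape m r) (x y : Fin m → ℝ) : ℝ :=
  (hashMatrix τ *ᵥ (signMatrix τ *ᵥ x)) ⬝ᵥ (hashMatrix τ *ᵥ (signMatrix τ *ᵥ y)) - x ⬝ᵥ y

/-- The indicator of a collision. -/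
def collision (h : Fin m → Fin r) (p : Fin m × Fin m) : ℝ := if h p.1 = h p.2 then 1 else 0

/-- Diagonal terms always collide and have squared signs, so they sum to exactly `x ⬝ᵥ y` and
cancel. -/
theorem sketchError_eq (τ : Tape m r) (x y : Fin m → ℝ) :
    sketchError τ x y = ∑ p ∈ Finset.univ.offDiag, x p.1 * y p.2 * collision τ.1 p *
      (sign (τ.2 p.1) * sign (τ.2 p.2)) := by
  have h1 : ∀ z : Fin m → ℝ, ∀ k, (hashMatrix τ *ᵥ (signMatrix τ *ᵥ z)) k =
      ∑ i, if τ.1 i = k then sign (τ.2 i) * z i else 0 := by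
    intro z k
    simp [hashMatrix, signMatrix, Matrix.mulVec, dotProduct, Matrix.diagonal_apply]
  have h2 : (hashMatrix τ *ᵥ (signMatrix τ *ᵥ x)) ⬝ᵥ (hashMatrix τ *ᵥ (signMatrix τ *ᵥ y)) =
      ∑ p : Fin m × Fin m, x p.1 * y p.2 * collision τ.1 p *
        (sign (τ.2 p.1) * sign (τ.2 p.2)) := by
    rw [dotProduct]
    simp only [h1, Finset.sum_mul_sum]
    rw [Finset.sum_comm, Fintype.sum_prod_type]
    refine Finset.sum_congr rfl fun i _ => ?_
    rw [Finset.sum_comm]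
    refine Finset.sum_congr rfl fun j _ => ?_
    rw [Finset.sum_eq_single (τ.1 i) (fun k _ hk => by simp [hk.symm]) (by simp)]
    by_cases h : τ.1 i = τ.1 j
    · simp [collision, h]
      ring
    · simp [collision, h, Ne.symm h]
  have h3 : x ⬝ᵥ y = ∑ p ∈ (Finset.univ : Finset (Fin m)).diag,
      x p.1 * y p.2 * collision τ.1 p * (sign (τ.2 p.1) * sign (τ.2 p.2)) := by
    rw [Finset.sum_diag]
    simp [dotProduct, collision, sign_mul_self]
  rw [sketchError, h2, h3, ← Finset.univ_product_univ, ← Finset.diag_union_offDiag,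
    Finset.sum_union (Finset.disjoint_diag_offDiag _), add_sub_cancel_left]

/-- The product of the signs of two different pairs has mean zero. -/
theorem sum_sign_eq_zero {p q : Fin m × Fin m} (hp : p.1 ≠ p.2) (hq : q.1 ≠ q.2)
    (h1 : q ≠ p) (h2 : q ≠ p.swap) :
    ∑ d : Fin m → Bool, (sign (d p.1) * sign (d p.2)) * (sign (d q.1) * sign (d q.2)) = 0 := by
  -- Flipping the sign at an index that occurs exactly once among the four is an involution that
  -- negates the summand. Such an index exists because the two unordered pairs differ.
  have flip : ∀ a : Fin m, (∀ d : Fin m → Bool,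
      (sign (Function.update d a (!d a) p.1) * sign (Function.update d a (!d a) p.2)) *
        (sign (Function.update d a (!d a) q.1) * sign (Function.update d a (!d a) q.2)) =
      -((sign (d p.1) * sign (d p.2)) * (sign (d q.1) * sign (d q.2)))) →
      ∑ d : Fin m → Bool, (sign (d p.1) * sign (d p.2)) * (sign (d q.1) * sign (d q.2)) = 0 := by
    intro a ha
    refine Finset.sum_involution (fun d _ => Function.update d a (!d a)) (fun d _ => ?_)
      (fun d _ _ h => ?_) (fun _ _ => Finset.mem_univ _) (fun d _ => by simp)
    · rw [ha, add_neg_cancel]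
    · have := congrFun h a
      simp at this
  obtain ⟨i, j⟩ := p
  obtain ⟨k, l⟩ := q
  simp only [ne_eq, Prod.mk.injEq, Prod.swap_prod_mk] at *
  by_cases hi : i = k ∨ i = l
  · have hj : j ≠ k ∧ j ≠ l := by
      constructor <;> rintro rfl <;> rcases hi with rfl | rfl <;> simp_all
    refine flip j fun d => ?_
    rw [Function.update_of_ne hp, Function.update_of_ne hj.1.symm, Function.update_of_ne hj.2.symm,
      Function.update_self, sign_not]
    ring
  · rw [not_or] at hi
    refine flip i fun d => ?_
    rw [Function.update_of_ne (Ne.symm hp), Function.update_of_ne (Ne.symm hi.1),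
      Function.update_of_ne (Ne.symm hi.2), Function.update_self, sign_not]
    ring

/-- Once all hash values but that of `p.1` are fixed, exactly one of the r remaining choices
collides. -/
theorem sum_collision {p : Fin m × Fin m} (hp : p.1 ≠ p.2) :
    (r : ℝ) * ∑ h : Fin m → Fin r, collision h p = Fintype.card (Fin m → Fin r) := by
  have e : ∀ F : (Fin m → Fin r) → ℝ, ∑ h, F h =
      ∑ g : {j // j ≠ p.1} → Fin r, ∑ c : Fin r, F ((Equiv.funSplitAt p.1 (Fin r)).symm (c, g)) := by
    intro F
    rw [← (Equiv.funSplitAt p.1 (Fin r)).symm.sum_comp, Fintype.sum_prod_type, Finset.sum_comm]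
  have h1 : (Fintype.card (Fin m → Fin r) : ℝ) = ∑ h : Fin m → Fin r, (1 : ℝ) := by simp
  rw [h1, e, e, Finset.mul_sum]
  refine Finset.sum_congr rfl fun g _ => ?_
  have h2 : ∀ c, collision ((Equiv.funSplitAt p.1 (Fin r)).symm (c, g)) p =
      if c = g ⟨p.2, hp.symm⟩ then 1 else 0 := fun c => by
    simp [collision, Equiv.funSplitAt, Equiv.piSplitAt, hp.symm]
  simp [h2]

theorem sum_sq_sketchError_le (x y : Fin m → ℝ) :
    (r : ℝ) * ∑ τ : Tape m r, sketchError τ x y ^ 2 ≤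
      Fintype.card (Tape m r) * ((x ⬝ᵥ x) * (y ⬝ᵥ y) + (x ⬝ᵥ y) ^ 2) := by
  set P := (Finset.univ : Finset (Fin m)).offDiag
  set X : Fin m × Fin m → ℝ := fun p => x p.1 * y p.2
  set σ : (Fin m → Bool) → Fin m × Fin m → ℝ := fun d p => sign (d p.1) * sign (d p.2)
  have hσ : ∀ d p, σ d p * σ d p = 1 := fun d p => by
    simp only [σ]
    rw [mul_mul_mul_comm, sign_mul_self, sign_mul_self, one_mul]
  have hσs : ∀ d p, σ d p.swap = σ d p := fun d p => mul_comm _ _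
  have hcs : ∀ (h : Fin m → Fin r) p, collision h p.swap = collision h p := fun h p => by
    simp [collision, eq_comm]
  have hcc : ∀ (h : Fin m → Fin r) p, collision h p * collision h p = collision h p := fun h p => by
    simp [collision]
  have h1 : ∑ τ : Tape m r, sketchError τ x y ^ 2 =
      ∑ p ∈ P, ∑ q ∈ P, X p * X q * ((∑ h : Fin m → Fin r, collision h p * collision h q) *
        ∑ d, σ d p * σ d q) := by
    simp only [sketchError_eq, sq, Finset.sum_mul_sum]
    rw [Finset.sum_comm]
    refine Finset.sum_congr rfl fun p _ => ?_
    rw [Finset.sum_comm]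
    refine Finset.sum_congr rfl fun q _ => ?_
    rw [Fintype.sum_prod_type, Finset.mul_sum]
    refine Finset.sum_congr rfl fun h _ => ?_
    rw [Finset.mul_sum]
    refine Finset.sum_congr rfl fun d _ => ?_
    simp only [X, σ]
    ring
  -- Only `q = p` and `q = p.swap` survive averaging over the signs.
  have h2 : ∀ p ∈ P, ∑ q ∈ P, X p * X q *
      ((∑ h : Fin m → Fin r, collision h p * collision h q) * ∑ d, σ d p * σ d q) =
      (X p * X p + X p * X p.swap) *
        ((∑ h : Fin m → Fin r, collision h p) * Fintype.card (Fin m → Bool)) := by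
    intro p hp
    have hp' : p.1 ≠ p.2 := (Finset.mem_offDiag.mp hp).2.2
    have hps : p ≠ p.swap := fun h0 => hp' (congrArg Prod.fst h0)
    have hsub : ({p, p.swap} : Finset (Fin m × Fin m)) ⊆ P := by
      intro q hq
      rcases Finset.mem_insert.mp hq with rfl | hq
      · exact hp
      · rw [Finset.mem_singleton.mp hq]
        simpa [P] using hp'.symm
    rw [← Finset.sum_subset hsub fun q hq hq' => ?_, Finset.sum_pair hps]
    · simp only [hσs, hcs, hσ, hcc]
      simp
      ring
    · rw [Finset.mem_insert, Finset.mem_singleton, not_or] at hq'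
      rw [sum_sign_eq_zero hp' (Finset.mem_offDiag.mp hq).2.2 hq'.1 hq'.2, mul_zero, mul_zero]
  have h3 : (r : ℝ) * ∑ τ : Tape m r, sketchError τ x y ^ 2 =
      Fintype.card (Tape m r) * ∑ p ∈ P, (X p * X p + X p * X p.swap) := by
    rw [h1, Finset.sum_congr rfl h2, Finset.mul_sum, Finset.mul_sum]
    refine Finset.sum_congr rfl fun p hp => ?_
    have := sum_collision (r := r) (Finset.mem_offDiag.mp hp).2.2
    rw [Fintype.card_prod, Nat.cast_mul, ← this]
    ring
  have h4 : (x ⬝ᵥ x) * (y ⬝ᵥ y) + (x ⬝ᵥ y) ^ 2 =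
      ∑ p : Fin m × Fin m, (X p * X p + X p * X p.swap) := by
    rw [Finset.sum_add_distrib, sq, dotProduct, dotProduct, dotProduct, Finset.sum_mul_sum,
      Finset.sum_mul_sum, Fintype.sum_prod_type, Fintype.sum_prod_type]
    congr 1 <;>
    · refine Finset.sum_congr rfl fun i _ => Finset.sum_congr rfl fun j _ => ?_
      simp only [X, Prod.swap]
      ring
  rw [h3, h4, ← Finset.univ_product_univ, ← Finset.diag_union_offDiag,
    Finset.sum_union (Finset.disjoint_diag_offDiag _), Finset.sum_diag]
  -- The diagonal terms missing from the exact second moment are the nonnegative numbers 2 x_i²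
  -- y_i².
  refine mul_le_mul_of_nonneg_left (le_add_of_nonneg_left ?_) (Nat.cast_nonneg _)
  refine Finset.sum_nonneg fun i _ => ?_
  simp only [Prod.swap]
  nlinarith [mul_self_nonneg (X (i, i))]

end SecondMoment

/-! ### From second moments to a subspace embedding -/

section SubspaceEmbedding

variable {m r k : ℕ}

theorem sum_frobenius_le {u : Fin k → Fin m → ℝ} (hu : ∀ i j, u i ⬝ᵥ u j = if i = j then 1 else 0) :
    (r : ℝ) * ∑ τ : Tape m r, ∑ a, ∑ b, sketchError τ (u a) (u b) ^ 2 ≤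
      Fintype.card (Tape m r) * ((k : ℝ) ^ 2 + k) := by
  have h1 : ∑ τ : Tape m r, ∑ a, ∑ b, sketchError τ (u a) (u b) ^ 2 =
      ∑ a, ∑ b, ∑ τ : Tape m r, sketchError τ (u a) (u b) ^ 2 := by
    rw [Finset.sum_comm]
    exact Finset.sum_congr rfl fun a _ => Finset.sum_comm
  have h2 : ((k : ℝ) ^ 2 + k) = ∑ a, ∑ b,
      ((u a ⬝ᵥ u a) * (u b ⬝ᵥ u b) + (u a ⬝ᵥ u b) ^ 2) := by
    simp [hu, Finset.sum_add_distrib, sq]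
  rw [h1, h2]
  simp only [Finset.mul_sum]
  exact Finset.sum_le_sum fun a _ => Finset.sum_le_sum fun b _ => by
    rw [← Finset.mul_sum]; exact sum_sq_sketchError_le _ _

theorem sketchError_combination (τ : Tape m r) (u : Fin k → Fin m → ℝ) (c d : Fin k → ℝ) :
    sketchError τ (∑ a, c a • u a) (∑ b, d b • u b) =
      ∑ a, ∑ b, c a * d b * sketchError τ (u a) (u b) := by
  have h : ∀ {q : ℕ} (v : Fin k → Fin q → ℝ), (∑ a, c a • v a) ⬝ᵥ (∑ b, d b • v b) =
      ∑ a, ∑ b, c a * d b * (v a ⬝ᵥ v b) := fun v => by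
    simp only [sum_dotProduct, dotProduct_sum, smul_dotProduct, dotProduct_smul, smul_eq_mul,
      Finset.mul_sum]
    rw [Finset.sum_comm]
    exact Finset.sum_congr rfl fun a _ => Finset.sum_congr rfl fun b _ => by ring
  simp only [sketchError, mul_sub, Finset.sum_sub_distrib, Matrix.mulVec_sum, Matrix.mulVec_smul, h]

/-- The operator norm of the error matrix is at most its Frobenius norm: Cauchy–Schwarz over index
pairs, then Bessel for each vector. -/
theorem abs_sketchError_le {τ : Tape m r} {u : Fin k → Fin m → ℝ}
    (hu : ∀ i j, u i ⬝ᵥ u j = if i = j then 1 else 0) {e : ℝ} (he : 0 ≤ e)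
    (hτ : ∑ a, ∑ b, sketchError τ (u a) (u b) ^ 2 ≤ e ^ 2) {x y : Fin m → ℝ}
    (hx : x = ∑ a, (x ⬝ᵥ u a) • u a) (hy : y = ∑ a, (y ⬝ᵥ u a) • u a) :
    |sketchError τ x y| ≤ e * (l2norm x * l2norm y) := by
  have h1 : sketchError τ x y =
      ∑ p : Fin k × Fin k, ((x ⬝ᵥ u p.1) * (y ⬝ᵥ u p.2)) * sketchError τ (u p.1) (u p.2) := by
    conv_lhs => rw [hx, hy]
    rw [sketchError_combination, Fintype.sum_prod_type]
  have h2 : ∑ p : Fin k × Fin k, ((x ⬝ᵥ u p.1) * (y ⬝ᵥ u p.2)) ^ 2 ≤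
      l2norm x ^ 2 * l2norm y ^ 2 := by
    rw [l2norm_sq, l2norm_sq, Fintype.sum_prod_type]
    simp only [mul_pow]
    rw [← Finset.sum_mul_sum]
    exact mul_le_mul (sum_sq_dot_le hu x) (sum_sq_dot_le hu y)
      (Finset.sum_nonneg fun _ _ => sq_nonneg _) (by rw [← l2norm_sq]; positivity)
  have h3 : sketchError τ x y ^ 2 ≤ (e * (l2norm x * l2norm y)) ^ 2 := by
    rw [h1]
    refine (Finset.sum_mul_sq_le_sq_mul_sq _ _ _).trans ?_
    rw [← Fintype.sum_prod_type'] at hτ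
    calc _ ≤ (l2norm x ^ 2 * l2norm y ^ 2) * e ^ 2 :=
          mul_le_mul h2 hτ (Finset.sum_nonneg fun _ _ => sq_nonneg _) (by positivity)
      _ = _ := by ring
  exact abs_le_of_sq_le_sq h3 (mul_nonneg he (mul_nonneg (l2norm_nonneg _) (l2norm_nonneg _)))

/-- Markov's inequality for a finite uniform distribution. -/
theorem one_sub_le_tapeLaw_real {G : Tape m r → ℝ} (hG : ∀ τ, 0 ≤ G τ) {c δ : ℝ} (hc : 0 < c)
    (hr : 0 < r) (h : ∑ τ, G τ ≤ Fintype.card (Tape m r) * (δ * c)) {S : Set (Tape m r)}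
    (hS : ∀ τ, G τ ≤ c → τ ∈ S) : 1 - δ ≤ (tapeLaw m r).real S := by
  classical
  have hcard : (0 : ℝ) < Fintype.card (Tape m r) := by
    have : Nonempty (Tape m r) := ⟨(fun _ => ⟨0, hr⟩, fun _ => true)⟩
    exact_mod_cast Fintype.card_pos
  have h1 : (tapeLaw m r).real S =
      ((Finset.univ.filter (· ∈ S)).card : ℝ) / Fintype.card (Tape m r) := by
    have h0 : S = ((Finset.univ.filter (· ∈ S) : Finset (Tape m r)) : Set (Tape m r)) := by
      ext τ; simp
    rw [MeasureTheory.measureReal_def, tapeLaw, ProbabilityTheory.uniformOn_univ]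
    conv_lhs => rw [h0]
    rw [MeasureTheory.Measure.count_apply_finset, ENNReal.toReal_div]
    simp
  have h2 : ((Finset.univ.filter (· ∉ S)).card : ℝ) * c ≤ Fintype.card (Tape m r) * (δ * c) := by
    refine le_trans ?_ h
    rw [← nsmul_eq_mul, ← Finset.sum_const]
    refine (Finset.sum_le_sum fun τ hτ => ?_).trans
      (Finset.sum_le_sum_of_subset_of_nonneg (Finset.subset_univ _) fun τ _ _ => hG τ)
    rw [Finset.mem_filter] at hτ
    exact (lt_of_not_ge fun h0 => hτ.2 (hS τ h0)).le
  have h3 : ((Finset.univ.filter (· ∈ S)).card : ℝ) + (Finset.univ.filter (· ∉ S)).card =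
      Fintype.card (Tape m r) := by
    rw [← Nat.cast_add, Finset.card_filter_add_card_filter_not, Finset.card_univ]
  rw [h1, le_div_iff₀ hcard]
  have h4 : ((Finset.univ.filter (· ∉ S)).card : ℝ) ≤ Fintype.card (Tape m r) * δ := by
    refine le_of_mul_le_mul_right ?_ hc
    linarith
  linarith

end SubspaceEmbedding

/-! ### The probability bound and the total cost -/

section Main

variable {m n l : ℕ}

/-- The matrix `[A; B]` with columns numbered by `Fin (n + l)`. -/
def joined (A : Matrix (Fin m) (Fin n) ℝ) (B : Matrix (Fin m) (Fin l) ℝ) :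
    Matrix (Fin m) (Fin (n + l)) ℝ :=
  (Matrix.fromCols A B).submatrix id finSumFinEquiv.symm

theorem rank_joined (A : Matrix (Fin m) (Fin n) ℝ) (B : Matrix (Fin m) (Fin l) ℝ) :
    (joined A B).rank = (Matrix.fromCols A B).rank :=
  Matrix.rank_submatrix _ (Equiv.refl _) _

theorem joined_mulVec (A : Matrix (Fin m) (Fin n) ℝ) (B : Matrix (Fin m) (Fin l) ℝ)
    (z : Fin n → ℝ) (w : Fin l → ℝ) :
    joined A B *ᵥ (Sum.elim z w ∘ finSumFinEquiv.symm) = A *ᵥ z + B *ᵥ w := by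
  rw [joined, Matrix.submatrix_mulVec_equiv, Function.comp_assoc, Equiv.self_comp_symm,
    Function.comp_id, Function.comp_id, Matrix.fromCols_mulVec]
  simp

/-- One basis for both column spaces lets a single Frobenius bound control the inner products within
and between them. -/
theorem exists_orthonormal_family (A : Matrix (Fin m) (Fin n) ℝ) (B : Matrix (Fin m) (Fin l) ℝ) :
    ∃ u : Fin (Matrix.fromCols A B).rank → Fin m → ℝ,
      (∀ i j, u i ⬝ᵥ u j = if i = j then 1 else 0) ∧
      (∀ z, A *ᵥ z = ∑ a, ((A *ᵥ z) ⬝ᵥ u a) • u a) ∧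
      ∀ w, B *ᵥ w = ∑ a, ((B *ᵥ w) ⬝ᵥ u a) • u a := by
  rw [← rank_joined, ← length_orthonormalize]
  have h := mulVec_eq_sum_orthonormalize (joined A B)
  refine ⟨fun a => ((orthonormalize (joined A B)).val.get a).1,
    (orthonormalize_spec _).1.dot_get, fun z => ?_, fun w => ?_⟩
  · have h1 := joined_mulVec A B z 0
    rw [Matrix.mulVec_zero, add_zero] at h1
    rw [← h1]
    exact h _
  · have h1 := joined_mulVec A B 0 w
    rw [Matrix.mulVec_zero, zero_add] at h1
    rw [← h1]
    exact h _

theorem sketch_mulVec {r : ℕ} (τ : Tape m r) (A : Matrix (Fin m) (Fin n) ℝ) (z : Fin n → ℝ) :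
    sketch τ A *ᵥ z = hashMatrix τ *ᵥ (signMatrix τ *ᵥ (A *ᵥ z)) := by
  rw [sketch, Matrix.mulVec_mulVec, Matrix.mulVec_mulVec, Matrix.mul_assoc]

theorem isApproxCCA_probability (A : Matrix (Fin m) (Fin n) ℝ) (B : Matrix (Fin m) (Fin l) ℝ)
    {r : ℕ} {ε δ : ℝ} (hε : 0 < ε) (hε1 : ε ≤ 1) (hδ : 0 < δ) (hr0 : 0 < r)
    (hr : 243 * (((Matrix.fromCols A B).rank : ℝ) ^ 2 + (Matrix.fromCols A B).rank) /
      (ε ^ 2 * δ) ≤ r) :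
    1 - δ ≤ (tapeLaw m r).real
      {τ | ∀ out : Output n l, IsExactCCA (sketch τ A) (sketch τ B) out →
        IsApproxCCA A B ε out} := by
  obtain ⟨u, hu, huA, huB⟩ := exists_orthonormal_family A B
  have hc : 0 < ε ^ 2 / 243 := by positivity
  have hrpos : (0 : ℝ) < r := by exact_mod_cast hr0
  refine one_sub_le_tapeLaw_real
    (G := fun τ => ∑ a, ∑ b, sketchError τ (u a) (u b) ^ 2)
    (fun τ => Finset.sum_nonneg fun _ _ => Finset.sum_nonneg fun _ _ => sq_nonneg _) hc hr0 ?_ ?_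
  · have h1 := sum_frobenius_le (r := r) hu
    rw [div_le_iff₀ (by positivity)] at hr
    refine le_of_mul_le_mul_left (h1.trans ?_) hrpos
    calc _ ≤ (Fintype.card (Tape m r) : ℝ) * (r * (ε ^ 2 * δ) / 243) :=
          mul_le_mul_of_nonneg_left (by linarith) (Nat.cast_nonneg _)
      _ = _ := by ring
  · intro τ hτ out hout
    have he0 := Real.sqrt_nonneg (ε ^ 2 / 243)
    have hτ' : ∑ a, ∑ b, sketchError τ (u a) (u b) ^ 2 ≤ Real.sqrt (ε ^ 2 / 243) ^ 2 := by
      rwa [Real.sq_sqrt hc.le]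
    -- The deterministic part needs 4e ≤ ε, for which 16 in place of 243 would suffice.
    have he : Real.sqrt (ε ^ 2 / 243) ≤ ε / 4 := by
      rw [Real.sqrt_le_left (by positivity)]
      nlinarith [sq_nonneg ε]
    refine hout.isApproxCCA (e := Real.sqrt (ε ^ 2 / 243)) (fun z w => ?_) (fun z w => ?_)
      (fun z w => ?_) he0 (by linarith) hε1
    all_goals
      rw [sketch_mulVec, sketch_mulVec]
      exact abs_sketchError_le hu he0 hτ' (by first | exact huA _ | exact huB _)
        (by first | exact huA _ | exact huB _)

theorem fastCCA_isExactCCA {A : Matrix (Fin m) (Fin n) ℝ} {B : Matrix (Fin m) (Fin l) ℝ}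
    (ε δ : ℝ) {LA : List (Fin m × Fin n × ℝ)} {LB : List (Fin m × Fin l × ℝ)}
    (hA : IsSparseRep A LA) (hB : IsSparseRep B LB) (τ : Tape m (sketchSize m n l ε δ)) :
    IsExactCCA (sketch τ A) (sketch τ B) (fastCCA ε δ LA LB τ).val := by
  have h : (fastCCA ε δ LA LB τ).val =
      (bjorckGolub (sketchSparse τ.1 (fun i => sign (τ.2 i)) LA).val
        (sketchSparse τ.1 (fun i => sign (τ.2 i)) LB).val).val := rfl
  rw [h, sketchSparse_val hA, sketchSparse_val hB]
  exact bjorckGolub_isExactCCA _ _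

theorem fastCCA_steps_le {A : Matrix (Fin m) (Fin n) ℝ} {B : Matrix (Fin m) (Fin l) ℝ}
    (ε δ : ℝ) {LA : List (Fin m × Fin n × ℝ)} {LB : List (Fin m × Fin l × ℝ)} (hl : l ≤ n)
    (hA : IsSparseRep A LA) (hB : IsSparseRep B LB) (τ : Tape m (sketchSize m n l ε δ)) :
    (fastCCA ε δ LA LB τ).steps ≤ 9 + 6 * m + 7 * (nnz A + nnz B) +
      4 * (n + 1) * sketchSize m n l ε δ + 100 * (n ^ 2 * sketchSize m n l ε δ + n ^ 3) := by
  have h1 := sketchSparse_steps_le τ.1 (fun i => sign (τ.2 i)) LA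
  have h2 := sketchSparse_steps_le τ.1 (fun i => sign (τ.2 i)) LB
  rw [hA.length_eq] at h1
  rw [hB.length_eq] at h2
  have h3 := bjorckGolub_steps_le (sketchSparse τ.1 (fun i => sign (τ.2 i)) LA).val
    (sketchSparse τ.1 (fun i => sign (τ.2 i)) LB).val hl
  -- The two tables of draws cost 3 steps per entry, which accounts for `6 * m`.
  have h4 : (fastCCA ε δ LA LB τ).steps = 9 + ((∑ _ : Fin m, (1 + 2)) + ((∑ _ : Fin m, (1 + 2)) +
      ((sketchSparse τ.1 (fun i => sign (τ.2 i)) LA).steps +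
        ((sketchSparse τ.1 (fun i => sign (τ.2 i)) LB).steps +
          (bjorckGolub (sketchSparse τ.1 (fun i => sign (τ.2 i)) LA).val
            (sketchSparse τ.1 (fun i => sign (τ.2 i)) LB).val).steps)))) := rfl
  have h5 : sketchSize m n l ε δ * (l * 2 + 2) ≤ sketchSize m n l ε δ * (n * 2 + 2) := by gcongr
  rw [h4, Finset.sum_const, Finset.card_univ, Fintype.card_fin, smul_eq_mul]
  linarith

/-- The constant is 243 · 6 + 1: the factor 6 from `l ≤ n`, and 1 from rounding up. -/
theorem sketchSize_le {ε δ : ℝ} (hn : 0 < n) (hl : l ≤ n) (hε : 0 < ε) (hε1 : ε ≤ 1) (hδ : 0 < δ)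
    (hδ1 : δ ≤ 1) :
    (sketchSize m n l ε δ : ℝ) ≤ 1459 * ((n : ℝ) ^ 2 * ((ε ^ 2)⁻¹ * δ⁻¹)) := by
  have hn1 : (1 : ℝ) ≤ n := by exact_mod_cast hn
  have hl1 : (l : ℝ) ≤ n := by exact_mod_cast hl
  have hE : 1 ≤ (ε ^ 2)⁻¹ * δ⁻¹ := by
    rw [← mul_inv]
    exact (one_le_inv₀ (by positivity)).mpr (mul_le_one₀ (pow_le_one₀ hε.le hε1) hδ.le hδ1)
  have h1 : (sketchSize m n l ε δ : ℝ) ≤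
      243 * (((n : ℝ) + l) ^ 2 + ((n : ℝ) + l)) / (ε ^ 2 * δ) + 1 := by
    refine le_trans (Nat.cast_le.mpr (min_le_left _ _)) ?_
    exact (Nat.ceil_lt_add_one (by positivity)).le
  rw [div_eq_mul_inv, mul_inv] at h1
  set E := (ε ^ 2)⁻¹ * δ⁻¹
  have h2 : ((n : ℝ) + l) ^ 2 + ((n : ℝ) + l) ≤ 6 * (n : ℝ) ^ 2 := by nlinarith
  have h3 := mul_le_mul_of_nonneg_right h2 (zero_le_one.trans hE)
  have h4 : 1 ≤ (n : ℝ) ^ 2 * E := one_le_mul_of_one_le_of_one_le (one_le_pow₀ hn1) hE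
  linarith

/-- Since ω ≤ n + l, the uncapped size is large enough; the assumption on `m` makes the cap
harmless. -/
theorem le_sketchSize (A : Matrix (Fin m) (Fin n) ℝ) (B : Matrix (Fin m) (Fin l) ℝ) {ε δ : ℝ}
    (hδ : 0 < δ)
    (h : 243 * (((Matrix.fromCols A B).rank : ℝ) ^ 2 + (Matrix.fromCols A B).rank) /
      (ε ^ 2 * δ) ≤ m) :
    243 * (((Matrix.fromCols A B).rank : ℝ) ^ 2 + (Matrix.fromCols A B).rank) / (ε ^ 2 * δ) ≤
      sketchSize m n l ε δ := by
  rw [sketchSize, Nat.cast_min]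
  refine le_min (le_trans ?_ (Nat.le_ceil _)) h
  have h1 : ((Matrix.fromCols A B).rank : ℝ) ≤ n + l := by
    have := (Matrix.fromCols A B).rank_le_card_width
    rw [Fintype.card_sum, Fintype.card_fin, Fintype.card_fin] at this
    exact_mod_cast this
  gcongr

theorem sketchSize_pos {ε δ : ℝ} (hm : 0 < m) (hn : 0 < n) (hε : 0 < ε) (hδ : 0 < δ) :
    0 < sketchSize m n l ε δ := by
  have : (0 : ℝ) < n := by exact_mod_cast hn
  exact lt_min (Nat.ceil_pos.mpr (by positivity)) hm

end Main

end CCA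

end

theorem mainTheorem3 :
    ∃ C₁ C₂ : ℝ, 0 < C₁ ∧ 0 < C₂ ∧
      ∀ (m n l : ℕ) (A : Matrix (Fin m) (Fin n) ℝ) (B : Matrix (Fin m) (Fin l) ℝ) (ε δ : ℝ),
        0 < m → 0 < n → l ≤ n → B.rank ≤ A.rank →
        0 < ε → ε < 1 / 3 → 0 < δ → δ < 1 →
        (243 * (((Matrix.fromCols A B).rank : ℝ) ^ 2 + (Matrix.fromCols A B).rank) / (ε ^ 2 * δ)
            ≤ m →
          1 - δ ≤ (CCA.tapeLaw m (CCA.sketchSize m n l ε δ)).real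
            {τ | ∀ out : CCA.Output n l,
              CCA.IsExactCCA (CCA.sketch τ A) (CCA.sketch τ B) out →
                CCA.IsApproxCCA A B (C₁ * ε) out}) ∧
        ∀ (LA : List (Fin m × Fin n × ℝ)) (LB : List (Fin m × Fin l × ℝ)),
          CCA.IsSparseRep A LA → CCA.IsSparseRep B LB →
            ∀ τ : CCA.Tape m (CCA.sketchSize m n l ε δ),
              CCA.IsExactCCA (CCA.sketch τ A) (CCA.sketch τ B) (CCA.fastCCA ε δ LA LB τ).val ∧
              ((CCA.fastCCA ε δ LA LB τ).steps : ℝ) ≤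
                C₂ * (m + CCA.nnz A + CCA.nnz B + (n : ℝ) ^ 4 * (ε ^ 2)⁻¹ * δ⁻¹) := by
  -- The second constant only has to exceed 108 · 1459 + 100, the coefficient collected for
  -- n⁴/(ε²δ); the coefficients of `m` and the nonzero counts are far smaller.
  refine ⟨1, 200000, one_pos, by norm_num, ?_⟩
  intro m n l A B ε δ hm hn hl _ hε hε1 hδ hδ1
  refine ⟨fun h => ?_, fun LA LB hA hB τ => ⟨CCA.fastCCA_isExactCCA ε δ hA hB τ, ?_⟩⟩
  · rw [one_mul]
    exact CCA.isApproxCCA_probability A B hε (by linarith) hδ (CCA.sketchSize_pos hm hn hε hδ)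
      (CCA.le_sketchSize A B hδ h)
  · have h1 : ((CCA.fastCCA ε δ LA LB τ).steps : ℝ) ≤ _ :=
      Nat.cast_le.mpr (CCA.fastCCA_steps_le ε δ hl hA hB τ)
    have h2 := CCA.sketchSize_le (m := m) hn hl hε (by linarith) hδ hδ1.le
    push_cast at h1
    have hn1 : (1 : ℝ) ≤ n := by exact_mod_cast hn
    have hm1 : (1 : ℝ) ≤ m := by exact_mod_cast hm
    have hE : 1 ≤ (ε ^ 2)⁻¹ * δ⁻¹ := by
      rw [← mul_inv]
      exact (one_le_inv₀ (by positivity)).mpr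
        (mul_le_one₀ (pow_le_one₀ hε.le (by linarith)) hδ.le hδ1.le)
    rw [mul_assoc ((n : ℝ) ^ 4)]
    generalize (ε ^ 2)⁻¹ * δ⁻¹ = E at h2 hE ⊢
    generalize (CCA.sketchSize m n l ε δ : ℝ) = r at h1 h2
    have hr : 4 * ((n : ℝ) + 1) * r + 100 * ((n : ℝ) ^ 2 * r) ≤ 108 * 1459 * ((n : ℝ) ^ 4 * E) := by
      have h3 : 4 * ((n : ℝ) + 1) * r + 100 * ((n : ℝ) ^ 2 * r) ≤
          (4 * ((n : ℝ) + 1) + 100 * (n : ℝ) ^ 2) * (1459 * ((n : ℝ) ^ 2 * E)) := by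
        rw [← mul_assoc 100, ← add_mul]
        exact mul_le_mul_of_nonneg_left h2 (by positivity)
      have h4 : (4 * ((n : ℝ) + 1) + 100 * (n : ℝ) ^ 2) ≤ 108 * (n : ℝ) ^ 2 := by nlinarith
      refine h3.trans ((mul_le_mul_of_nonneg_right h4 (by positivity)).trans (le_of_eq ?_))
      ring
    have hn4 : (n : ℝ) ^ 3 ≤ (n : ℝ) ^ 4 * E :=
      (pow_le_pow_right₀ hn1 (by norm_num)).trans (le_mul_of_one_le_right (by positivity) hE)
    have ha : (0 : ℝ) ≤ CCA.nnz A := Nat.cast_nonneg _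
    have hb : (0 : ℝ) ≤ CCA.nnz B := Nat.cast_nonneg _
    have hp : (0 : ℝ) ≤ (n : ℝ) ^ 4 * E := by positivity
    linarith
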